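/- **Conventions.** All graphs are directed, $\oplus$ is disjoint union, $c\times\mathcal G$ is the disjoint union of $c$ copies of $\mathcal G$, and $=$ between graphs means isomorphism. For a map $g$ on a set $V$, the functional graph $\mathcal G(g/V)$ has vertex set $V$ and edges $(a,g(a))$, $a\in V$. Rooted trees have their edges pointing towards the root; $\bullet$ is the one-vertex tree, and $\langle\bigoplus_i\mathcal T_i\rangle$ is the rooted tree whose children are the roots of the trees $\mathcal T_i$. $\mathrm{Cyc}(k,\mathcal T)$ is a directed cycle of length $k$ each node of which is the root of a copy of $\mathcal T$, and $\mathrm{Cyc}(k)=\mathrm{Cyc}(k,\bullet)$. For a non-increasing sequence of positive integers $V=(v_1,\dots,v_D)$ put $v_i=v_D$ for $i>D$, $\mathcal T_V^0=\bullet$, $$\mathcal T_V^k=\Big\langle v_k\times\mathcal T_V^{k-1}\oplus\bigoplus_{i=1}^{k-1}(v_i-v_{i+1})\times\mathcal T_V^{i-1}\Big\rangle\ (k\ge1),\qquad \mathcal T_V=\Big\langle (v_D-1)\times\mathcal T_V^{D-1}\oplus\bigoplus_{i=1}^{D-1}(v_i-v_{i+1})\times\mathcal T_V^{i-1}\Big\rangle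 .$$ For positive integers $n,v$ let $\gcd_n(v)=(v_1,\dots,v_s)$, where $v_i=\gcd(n^i,v)/\gcd(n^{i-1},v)$ and $s$ is the least positive integer with $v_s=1$. $\mathrm{ord}_M(b)$ is the multiplicative order of $b$ modulo $M$, and $\mu(\cdot)$ is the Möbius function. **Setting.** Let $\mathbb F_q$ be a finite field with $q$ elements, $\alpha$ a generator of $\mathbb F_q^*$, $m$ a positive divisor of $q-1$, $n\ge2$ an integer, $h\in\mathbb F_q[x]$, and $$f(x)=x^nh\big(x^{\frac{q-1}m}\big),\qquad \psi_f(x)=x^nh(x)^{\frac{q-1}m}.$$ (The monomial maps $x\mapsto ax^n$ are the case $m=1$, $h=a$.) Let $\mu_m\subset\mathbb F_q$ be the set of $m$-th roots of unity, and write $g^{(j)}$ for the $j$-th iterate of a map $g$. Assume that $f$ is *$m$-nice*, i.e. that $\psi_f$ is injective on $\{\xi\in\mu_m:\psi_f(\xi)\ne0\}$ (with values in $\mu_m$). Let $\psi_f^{-\infty}(0)=\{\gamma\in\mu_m:\psi_f^{(i)}(\gamma)=0\text{ for some } i\ge1\}$. Write $\frac{q-1}m=\nu\omega$, where $\omega$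 is the greatest divisor of $\frac{q-1}m$ coprime to $n$, and let $\omega'$ be the greatest divisor of $q-1$ coprime to $n$. Let $\mathcal G^{(1)}_{f/\mathbb F_q}$ be the graph $\mathcal G(f/\mathbb F_q)$ with the (weakly) connected component of $0$ removed. **Theorem.** Let $S_1,\dots,S_t\subset\mu_m$ be pairwise disjoint sets with $\mu_m\setminus\psi_f^{-\infty}(0)=S_1\cup\dots\cup S_t$ and $\mathcal G(\psi_f/S_i)=\mathrm{Cyc}(k_i)$. For each $i$ let $\xi_i\in S_i$ and let $\ell_i,r_i$ be integers with $$\xi_i=\alpha^{\frac{q-1}mr_i},\qquad \alpha^{\ell_i}=\prod_{j=0}^{k_i-1}h\big(\psi_f^{(j)}(\xi_i)\big)^{n^{k_i-j-1}}.$$ For $d\ge1$ let $$\tau_i(d)=\begin{cases}\gcd\big(\frac{q-1}m,\,n^{dk_i}-1\big)&\text{if }\gcd\big(q-1,(n^{dk_i}-1)m\big)\ \big|\ \ell_i\,\frac{n^{dk_i}-1}{n^{k_i}-1}+r_i\,(n^{dk_i}-1),\\[2pt]0&\text{otherwise.}\end{cases}$$ Then, for each $i$ and each positive divisor $u$ of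 $\mathrm{ord}_{\omega'(n^{k_i}-1)}(n^{k_i})$, the number $\frac1u\sum_{d\mid u}\mu(u/d)\,\tau_i(d)$ is a non-negative integer, and $$\mathcal G^{(1)}_{f/\mathbb F_q}=\bigoplus_{i=1}^{t}\ \bigoplus_{u\,\mid\,\mathrm{ord}_{\omega'(n^{k_i}-1)}(n^{k_i})}\Big(\frac{\sum_{d\mid u}\mu(\frac ud)\,\tau_i(d)}{u}\times\mathrm{Cyc}\big(k_iu,\ \mathcal T_{\gcd_n(\nu)}\big)\Big).$$ -/

import Mathlib

open Polynomial

namespace FunGraph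

/-! ### Digraphs: functional graphs, induced subgraphs, isomorphism, disjoint unions -/

/-- The functional graph of `g : V → V`: the edges are the pairs `(a, g a)`. -/
def functionalGraph {V : Type*} (g : V → V) : Digraph V where
  Adj a b := g a = b

/-- The subgraph of `G` induced on a set of vertices. -/
def induce {V : Type*} (G : Digraph V) (s : Set V) : Digraph s where
  Adj a b := G.Adj a b

/-- Isomorphism of digraphs. -/
def Iso {V W : Type*} (G : Digraph V) (H : Digraph W) : Prop :=
  Nonempty (G.Adj ≃r H.Adj)

/-- The disjoint union of a family of digraphs. -/
def disjointUnion {ι : Type*} {V : ι → Type*} (G : ∀ i, Digraph (V i)) : Digraph (Σ i, V i) where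
  Adj p p' := ∃ (i : ι) (x y : V i), p = ⟨i, x⟩ ∧ p' = ⟨i, y⟩ ∧ (G i).Adj x y

/-- The disjoint union of `c` copies of `G`. -/
def copies {V : Type*} (c : ℕ) (G : Digraph V) : Digraph (Σ _ : Fin c, V) :=
  disjointUnion fun _ : Fin c => G

/-- The vertices in the (weakly) connected component of `v`. -/
def component {V : Type*} (G : Digraph V) (v : V) : Set V :=
  {w | Relation.EqvGen G.Adj v w}

/-! ### Rooted trees with all edges pointing towards the root -/

/-- A rooted tree, as a digraph whose edges point towards the root. -/
structure InTree where
  /-- the vertices -/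
  V : Type
  /-- the edges -/
  graph : Digraph V
  /-- the root -/
  root : V
  root_out : ∀ y, ¬ graph.Adj root y
  existsUnique_out : ∀ x, x ≠ root → ∃! y, graph.Adj x y
  reaches_root : ∀ x, Relation.ReflTransGen graph.Adj x root

namespace InTree

/-- The tree with a single vertex. -/
def single : InTree where
  V := Unit
  graph := ⟨fun _ _ => False⟩
  root := ()
  root_out _ h := h
  existsUnique_out _ h := (h rfl).elim
  reaches_root _ := Relation.ReflTransGen.refl

/-- Edges of the tree `⟨⨁ T i⟩`: the new root is `none`, and the children of `none` are the
roots of the trees `T i`. -/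
inductive JoinAdj {ι : Type} (T : ι → InTree) : Option (Σ i, (T i).V) → Option (Σ i, (T i).V) → Prop
  | inner (i : ι) (x y : (T i).V) (h : (T i).graph.Adj x y) : JoinAdj T (some ⟨i, x⟩) (some ⟨i, y⟩)
  | outer (i : ι) : JoinAdj T (some ⟨i, (T i).root⟩) none

/-- The rooted tree `⟨⨁ T i⟩`, whose children are the roots of the trees `T i`. -/
def join {ι : Type} (T : ι → InTree) : InTree where
  V := Option (Σ i, (T i).V)
  graph := ⟨JoinAdj T⟩
  root := none
  root_out y h := by cases h
  existsUnique_out x hx := by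
    rcases x with _ | ⟨i, x⟩
    · exact (hx rfl).elim
    · by_cases hr : x = (T i).root
      · subst hr
        refine ⟨none, JoinAdj.outer i, ?_⟩
        intro y hy
        cases hy with
        | inner _ _ y h => exact ((T i).root_out y h).elim
        | outer => rfl
      · obtain ⟨y, hy, huniq⟩ := (T i).existsUnique_out x hr
        refine ⟨some ⟨i, y⟩, JoinAdj.inner i x y hy, ?_⟩
        intro z hz
        cases hz with
        | inner _ _ w h => rw [huniq w h]
        | outer => exact (hr rfl).elim
  reaches_root x := by
    rcases x with _ | ⟨i, x⟩
    · exact Relation.ReflTransGen.refl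
    · have key : ∀ y, Relation.ReflTransGen (T i).graph.Adj x y →
          Relation.ReflTransGen (JoinAdj T) (some ⟨i, x⟩) (some ⟨i, y⟩) := by
        intro y hy
        induction hy with
        | refl => exact Relation.ReflTransGen.refl
        | tail _ hbc ih => exact ih.tail (JoinAdj.inner i _ _ hbc)
      exact (key _ ((T i).reaches_root x)).tail (JoinAdj.outer i)

end InTree

/-- `Cyc(k, T)`: a directed cycle of length `k`, each node of which is the root of a copy
of `T`. -/
def cyc (k : ℕ) (T : InTree) : Digraph (ZMod k × T.V) where
  Adj p p' := (p.1 = p'.1 ∧ T.graph.Adj p.2 p'.2) ∨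
    (p.2 = T.root ∧ p'.2 = T.root ∧ p'.1 = p.1 + 1)

/-! ### Elementary trees -/

/-- The entries `v₁, v₂, …` of `V = (v₁, …, v_D)`, continued by `v_i = v_D` for `i > D`. -/
def entry (V : List ℕ) (i : ℕ) : ℕ := V.getD (i - 1) (V.getLastD 0)

/-- The trees `T_V^k`:
`T_V^0 = •` and `T_V^k = ⟨v_k × T_V^(k-1) ⊕ ⨁_{1 ≤ i ≤ k-1} (v_i - v_(i+1)) × T_V^(i-1)⟩`.
Below `k` stands for `k - 1` and `i` for `i - 1`. -/
def elemTreeLevel (V : List ℕ) : ℕ → InTree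
  | 0 => InTree.single
  | k + 1 => InTree.join
      (Sum.elim
        (fun _ : Fin (entry V (k + 1)) => elemTreeLevel V k)
        (fun p : (Σ i : Fin k, Fin (entry V (i + 1) - entry V (i + 2))) =>
          elemTreeLevel V p.1))
termination_by k => k
decreasing_by
  · exact Nat.lt_succ_self k
  · exact Nat.lt_succ_of_lt p.1.isLt

/-- The elementary tree
`T_V = ⟨(v_D - 1) × T_V^(D-1) ⊕ ⨁_{1 ≤ i ≤ D-1} (v_i - v_(i+1)) × T_V^(i-1)⟩`. -/
def elemTree (V : List ℕ) : InTree :=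
  InTree.join
    (Sum.elim
      (fun _ : Fin (entry V V.length - 1) => elemTreeLevel V (V.length - 1))
      (fun p : (Σ i : Fin (V.length - 1), Fin (entry V (i + 1) - entry V (i + 2))) =>
        elemTreeLevel V p.1))

/-! ### Arithmetic -/

/-- `v_i = gcd(n^i, v) / gcd(n^(i-1), v)`, for `i ≥ 1`. -/
def gcdEntry (n v i : ℕ) : ℕ := Nat.gcd (n ^ i) v / Nat.gcd (n ^ (i - 1)) v

/-- The iterated gcd `gcd_n(v) = (v₁, …, v_s)`, where `s ≥ 1` is least with `v_s = 1`. -/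
noncomputable def iterGcd (n v : ℕ) : List ℕ :=
  (List.range (sInf {s | 0 < s ∧ gcdEntry n v s = 1})).map fun i => gcdEntry n v (i + 1)

/-- The greatest divisor of `N` coprime to `n` (for `N > 0`). -/
def coprimePart (n N : ℕ) : ℕ := (N.divisors.filter fun d => Nat.Coprime d n).sup id

/-- The number `τ(d)` attached to a cycle of length `k` with exponents `ℓ` and `r`. -/
def tau (q m n k : ℕ) (ℓ r : ℤ) (d : ℕ) : ℕ :=
  if ((Nat.gcd (q - 1) ((n ^ (d * k) - 1) * m) : ℕ) : ℤ) ∣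
      ℓ * (((n ^ (d * k) - 1) / (n ^ k - 1) : ℕ) : ℤ) + r * ((n ^ (d * k) - 1 : ℕ) : ℤ)
  then Nat.gcd ((q - 1) / m) (n ^ (d * k) - 1)
  else 0

/-! ### The polynomial `f = x^n h(x^((q-1)/m))` and its associated map on roots of unity -/

section Poly

variable {F : Type*} [Field F]

/-- `f(x) = x^n h(x^((q-1)/m))`. -/
noncomputable def fPoly (q m n : ℕ) (h : F[X]) : F[X] := X ^ n * h.comp (X ^ ((q - 1) / m))

/-- `ψ_f(x) = x^n h(x)^((q-1)/m)`, as a map. -/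
noncomputable def psi (q m n : ℕ) (h : F[X]) (x : F) : F :=
  (X ^ n * h ^ ((q - 1) / m)).eval x

/-- The set `μ_m` of `m`-th roots of unity in `F`. -/
def unityRoots (F : Type*) [Field F] (m : ℕ) : Set F := {x | x ^ m = 1}

/-- `f` is `m`-nice: `ψ_f` is injective on `μ_m \ ψ_f⁻¹(0)`. (That `ψ_f` maps this set to `μ_m`
holds automatically when `F` has `q` elements and `m ∣ q - 1`.) -/
def IsNice (q m n : ℕ) (h : F[X]) : Prop :=
  Set.InjOn (psi q m n h) (unityRoots F m \ {x | psi q m n h x = 0})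

/-- `ψ_f^{-∞}(0)`: the elements of `μ_m` that some positive iterate of `ψ_f` maps to `0`. -/
def psiNegInf (q m n : ℕ) (h : F[X]) : Set F :=
  {x | x ∈ unityRoots F m ∧ ∃ i : ℕ, 0 < i ∧ (psi q m n h)^[i] x = 0}

/-- The functional graph `G(f/F)`. -/
noncomputable def graphOf (f : F[X]) : Digraph F := functionalGraph fun x => f.eval x

/-- `G^(1)_{f/F}`: what remains of `G(f/F)` when the connected component of `0` is removed. -/
noncomputable def graphOne (f : F[X]) : Digraph ↥((component (graphOf f) 0)ᶜ) :=
  induce (graphOf f) (component (graphOf f) 0)ᶜ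

end Poly

end FunGraph

/-!
Put `M = (q - 1) / m`. Outside `0` the power map `x ↦ x ^ M` semiconjugates `f` to `ψ_f` on `μ_m`,
so the vertices outside the component of `0` are exactly the `x` whose power `x ^ M` lies on one of
the cycles `S i`. Over these cycles `f (ζ x) = ζ ^ n f x` for every `ζ` with `ζ ^ M = 1`, and
`ψ_f` is injective. The whole structure follows from these two facts.

*Trees.* Every nonempty fibre of `f^[j]` has exactly `gcd (n ^ j, M) = gcd (n ^ j, ν)` elements
(`ncard_iterate_fiber`). Sort the points by level, the largest `k` such that the point is a `k`-fold
iterated image. Comparing the fibres of `f^[j]` and `f^[j + 1]` counts the preimages of a point that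
have a given level (`ncard_preimage_range`, `ncard_preimage_range_diff`), and the counts are those
in the recursive definition of the elementary trees. Hence `T_V^k` hangs at each point of finite
level `k`, and `T_V`, with `V = gcd_n(ν)`, at each periodic point (`isTreeAt_elemTree`).

*Cycles.* With the same tree at all periodic points, the graph is determined by the number of cycles
of each length (`functionalGraph_iso_disjointUnion_cyc`). Over a cycle of length `k`, all periods
are multiples of `k`. Every fibre of `x ↦ x ^ M` over that cycle has the same number of fixed points
of `f^[k * d]`, and writing `x = α ^ e` over the point `ξ` turns the count into a linear congruence
for `e`, with `τ(d)` solutions (`ncard_fixed_fiber_eq_tau`). Möbius inversion gives the number of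
points of minimal period `k * u`. Only divisors `u` of the multiplicative order occur: for periodic
`x`, the ratio `f^[k] x / x` has order coprime to `n` (`iterate_orderOf_eq_self`).
-/

namespace FunGraph

open Function

/-! ### Backward trees in functional graphs -/

/-- `T` is the tree hanging at `y` in the functional graph of `f`: it embeds into the graph with its
root at `y` and all other vertices nonperiodic, and the image is closed under passing to
nonperiodic preimages. For a nonperiodic `y` this is the tree of all iterated preimages of `y`. -/
def IsTreeAt {X : Type*} (f : X → X) (y : X) (T : InTree) : Prop :=
  ∃ e : T.V → X, e T.root = y ∧ Injective e ∧ (∀ a b, T.graph.Adj a b → f (e a) = e b) ∧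
    (∀ a, a ≠ T.root → e a ∉ periodicPts f) ∧
    ∀ x b, x ∉ periodicPts f → f x = e b → ∃ a, e a = x ∧ T.graph.Adj a b

theorem exists_iterate_eq_root {X : Type*} {f : X → X} {T : InTree} {e : T.V → X}
    (he : ∀ a b, T.graph.Adj a b → f (e a) = e b) (a : T.V) : ∃ s, f^[s] (e a) = e T.root := by
  induction T.reaches_root a using Relation.ReflTransGen.head_induction_on with
  | refl => exact ⟨0, rfl⟩
  | head h _ ih =>
    obtain ⟨s, hs⟩ := ih
    exact ⟨s + 1, by rw [iterate_succ_apply, he _ _ h, hs]⟩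

/-- If trees hang at all nonperiodic preimages of `y`, then their join hangs at `y`. -/
theorem IsTreeAt.join {X : Type*} {f : X → X} {ι : Type} {T : ι → InTree} {c : ι → X} {y : X}
    (hc : Injective c) (hmem : ∀ x, (∃ i, c i = x) ↔ x ∉ periodicPts f ∧ f x = y)
    (hT : ∀ i, IsTreeAt f (c i) (T i)) : IsTreeAt f y (InTree.join T) := by
  choose e hroot hinj hadj hper hpre using hT
  have hcy : ∀ i, f (c i) = y := fun i => ((hmem _).1 ⟨i, rfl⟩).2
  have hcP : ∀ i, c i ∉ periodicPts f := fun i => ((hmem _).1 ⟨i, rfl⟩).1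
  have heP : ∀ i a, e i a ∉ periodicPts f := fun i a => by
    by_cases h : a = (T i).root
    · rw [h, hroot]; exact hcP i
    · exact hper i a h
  have hit : ∀ i a, ∃ s, f^[s] (e i a) = c i := fun i a => by
    obtain ⟨s, hs⟩ := exists_iterate_eq_root (hadj i) a
    exact ⟨s, hs.trans (hroot i)⟩
  -- a preimage of `y` in the forward orbit of `y` is periodic
  have hback : ∀ d i, f^[d] y ≠ c i := fun d i h =>
    hcP i ⟨d + 1, d.succ_pos, by
      change f^[d + 1] (c i) = c i
      rw [iterate_succ_apply, hcy, h]⟩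
  have huniq : ∀ z s t i j, s ≤ t → f^[s] z = c i → f^[t] z = c j → i = j := by
    intro z s t i j hst hs ht
    obtain ⟨d, rfl⟩ := Nat.exists_eq_add_of_le' hst
    rw [iterate_add_apply, hs] at ht
    rcases d with _ | d
    · exact hc ht
    · rw [iterate_succ_apply, hcy] at ht
      exact (hback d j ht).elim
  have hey : ∀ i a, e i a ≠ y := fun i a h => by
    obtain ⟨s, hs⟩ := hit i a
    rw [h] at hs
    exact hback s i hs
  let e' : (InTree.join T).V → X := fun v => match v with
    | none => y
    | some p => e p.1 p.2
  refine ⟨e', rfl, ?_, ?_, ?_, ?_⟩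
  · rintro (_ | ⟨i, a⟩) (_ | ⟨j, b⟩) hab
    · rfl
    · exact (hey j b hab.symm).elim
    · exact (hey i a hab).elim
    · change e i a = e j b at hab
      obtain ⟨s, hs⟩ := hit i a
      obtain ⟨t, ht⟩ := hit j b
      have hij : i = j := by
        rcases le_total s t with h | h
        · exact huniq _ s t i j h hs (hab ▸ ht)
        · exact (huniq _ t s j i h ht (hab ▸ hs)).symm
      subst hij
      rw [hinj i hab]
  · intro a b hab
    rcases hab with ⟨i, x, y, h⟩ | ⟨i⟩
    · exact hadj i x y h
    · change f (e i (T i).root) = y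
      rw [hroot, hcy]
  · rintro (_ | ⟨i, a⟩) ha
    · exact (ha rfl).elim
    · exact heP i a
  · rintro x (_ | ⟨i, b⟩) hx hxb
    · obtain ⟨i, hi⟩ := (hmem x).2 ⟨hx, hxb⟩
      exact ⟨some ⟨i, (T i).root⟩, (hroot i).trans hi, InTree.JoinAdj.outer i⟩
    · obtain ⟨a, ha, hab⟩ := hpre i x b hx hxb
      exact ⟨some ⟨i, a⟩, ha, InTree.JoinAdj.inner i a b hab⟩

/-! ### Isomorphisms of digraphs -/

theorem Iso.symm {V W : Type*} {G : Digraph V} {H : Digraph W} (h : Iso G H) : Iso H G :=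
  ⟨h.some.symm⟩

theorem Iso.trans {U V W : Type*} {G : Digraph U} {H : Digraph V} {K : Digraph W}
    (h : Iso G H) (h' : Iso H K) : Iso G K :=
  ⟨h.some.trans h'.some⟩

theorem disjointUnion_adj {ι : Type*} {V : ι → Type*} {G : ∀ i, Digraph (V i)} {i : ι} {x y : V i} :
    (disjointUnion G).Adj ⟨i, x⟩ ⟨i, y⟩ ↔ (G i).Adj x y := by
  constructor
  · rintro ⟨j, x', y', h, h', hadj⟩
    cases h
    cases h'
    exact hadj
  · exact fun h => ⟨i, x, y, rfl, rfl, h⟩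

theorem disjointUnion_adj_fst {ι : Type*} {V : ι → Type*} {G : ∀ i, Digraph (V i)} {p p' : Σ i, V i}
    (h : (disjointUnion G).Adj p p') : p.1 = p'.1 := by
  obtain ⟨j, x', y', rfl, rfl, -⟩ := h
  rfl

theorem Iso.disjointUnion {ι : Type*} {V W : ι → Type*} {G : ∀ i, Digraph (V i)}
    {H : ∀ i, Digraph (W i)} (h : ∀ i, Iso (G i) (H i)) :
    Iso (disjointUnion G) (disjointUnion H) := by
  have e := fun i => (h i).some
  refine ⟨⟨Equiv.sigmaCongrRight fun i => (e i).toEquiv, ?_⟩⟩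
  rintro ⟨i, x⟩ ⟨j, y⟩
  by_cases hij : i = j
  · subst hij
    exact disjointUnion_adj.trans ((e i).map_rel_iff.trans disjointUnion_adj.symm)
  · exact iff_of_false (fun h => hij (disjointUnion_adj_fst h))
      (fun h => hij (disjointUnion_adj_fst h))

/-! ### Functional graphs with the same tree at every periodic point -/

/-- The functional graph of `g` with a copy of the tree `T` attached to each vertex. -/
def treesOver {Q : Type*} (g : Q → Q) (T : InTree) : Digraph (Q × T.V) where
  Adj p p' := (p.1 = p'.1 ∧ T.graph.Adj p.2 p'.2) ∨
    (p.2 = T.root ∧ p'.2 = T.root ∧ p'.1 = g p.1)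

theorem disjointUnion_treesOver {ι : Type*} {Q : ι → Type*} (g : ∀ i, Q i → Q i) (T : InTree) :
    Iso (treesOver (fun p : Σ i, Q i => ⟨p.1, g p.1 p.2⟩) T)
      (disjointUnion fun i => treesOver (g i) T) := by
  refine ⟨⟨Equiv.sigmaProdDistrib Q T.V, ?_⟩⟩
  rintro ⟨⟨i, x⟩, a⟩ ⟨⟨j, y⟩, b⟩
  by_cases hij : i = j
  · subst hij
    refine disjointUnion_adj.trans ?_
    simp [treesOver]
  · refine iff_of_false (fun h => hij (disjointUnion_adj_fst h)) ?_
    rintro (⟨h, -⟩ | ⟨-, -, h⟩)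
    · exact hij (congrArg Sigma.fst h)
    · exact hij (congrArg Sigma.fst h).symm

theorem exists_iterate_mem_periodicPts {X : Type*} [Finite X] (f : X → X) (x : X) :
    ∃ s, f^[s] x ∈ periodicPts f := by
  obtain ⟨s, t, hst, h⟩ : ∃ s t, s < t ∧ f^[s] x = f^[t] x := by
    by_contra! hne
    exact not_injective_infinite_finite (f^[·] x) fun s t h => by
      by_contra hne'
      rcases lt_or_gt_of_ne hne' with hlt | hlt
      · exact hne _ _ hlt h
      · exact hne _ _ hlt h.symm
  refine ⟨s, t - s, Nat.sub_pos_of_lt hst, ?_⟩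
  change f^[t - s] (f^[s] x) = f^[s] x
  rw [← iterate_add_apply, Nat.sub_add_cancel hst.le, h]

/-- A finite functional graph with the same tree `T` at every periodic point is determined by `T`
and the permutation that the map induces on its periodic points. -/
theorem functionalGraph_iso_treesOver {X Q : Type*} [Finite X] (f : X → X) (T : InTree)
    (hT : ∀ p ∈ periodicPts f, IsTreeAt f p T) (g : Q → Q) (E : Q ≃ periodicPts f)
    (hE : ∀ a, (E (g a) : X) = f (E a)) : Iso (functionalGraph f) (treesOver g T) := by
  have hT' := fun a : Q => hT (E a) (E a).2
  choose e hroot hinj hadj hper hpre using hT'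
  let Φ : Q × T.V → X := fun p => e p.1 p.2
  have hsurj : ∀ s x, f^[s] x ∈ periodicPts f → ∃ p, Φ p = x := by
    intro s
    induction s with
    | zero =>
      intro x hx
      refine ⟨(E.symm ⟨x, hx⟩, T.root), ?_⟩
      change e _ _ = x
      rw [hroot, Equiv.apply_symm_apply]
    | succ s ih =>
      intro x hx
      by_cases hxP : x ∈ periodicPts f
      · refine ⟨(E.symm ⟨x, hxP⟩, T.root), ?_⟩
        change e _ _ = x
        rw [hroot, Equiv.apply_symm_apply]
      · rw [iterate_succ_apply] at hx
        obtain ⟨⟨p, b⟩, hb⟩ := ih _ hx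
        obtain ⟨a, ha, -⟩ := hpre p x b hxP hb.symm
        exact ⟨(p, a), ha⟩
  -- the base point of `e p a` is the first periodic point that its orbit meets
  have hinj1 : ∀ p a, ∀ q b, e p a = e q b → p = q := by
    intro p a
    induction T.reaches_root a using Relation.ReflTransGen.head_induction_on with
    | refl =>
      intro q b hab
      have hb : b = T.root := by
        by_contra hb
        exact hper q b hb (hab ▸ hroot p ▸ (E p).2)
      rw [hb, hroot, hroot] at hab
      exact E.injective (Subtype.ext hab)
    | @head a a' haa' _ ih =>
      intro q b hab
      have ha : a ≠ T.root := fun h => T.root_out a' (h ▸ haa')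
      have hb : b ≠ T.root := by
        rintro rfl
        exact hper p a ha (hab ▸ hroot q ▸ (E q).2)
      obtain ⟨b', hb', -⟩ := T.existsUnique_out b hb
      exact ih q b' (by rw [← hadj p _ _ haa', ← hadj q _ _ hb', hab])
  have hΦinj : Injective Φ := by
    rintro ⟨p, a⟩ ⟨q, b⟩ hab
    obtain rfl := hinj1 p a q b hab
    exact congrArg (p, ·) (hinj p hab)
  have hΦ : Bijective Φ := ⟨hΦinj, fun x =>
    let ⟨s, hs⟩ := exists_iterate_mem_periodicPts f x
    hsurj s x hs⟩
  refine Iso.symm ⟨⟨Equiv.ofBijective Φ hΦ, ?_⟩⟩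
  rintro ⟨p, a⟩ ⟨q, b⟩
  change f (e p a) = e q b ↔ (p = q ∧ T.graph.Adj a b) ∨ (a = T.root ∧ b = T.root ∧ q = g p)
  constructor
  · intro h
    by_cases ha : a = T.root
    · have h' : Φ (q, b) = Φ (g p, T.root) := by
        change e q b = e (g p) T.root
        rw [← h, ha, hroot, hroot, hE]
      have := hΦinj h'
      simp only [Prod.mk.injEq] at this
      exact Or.inr ⟨ha, this.2, this.1⟩
    · obtain ⟨a', ha', -⟩ := T.existsUnique_out a ha
      have h' : Φ (q, b) = Φ (p, a') := h.symm.trans (hadj p _ _ ha')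
      have := hΦinj h'
      simp only [Prod.mk.injEq] at this
      obtain ⟨rfl, rfl⟩ := this
      exact Or.inl ⟨rfl, ha'⟩
  · rintro (⟨rfl, h⟩ | ⟨rfl, rfl, rfl⟩)
    · exact hadj p _ _ h
    · rw [hroot, hroot, hE]

/-! ### Counting preimages level by level -/

theorem card_eq_mul_of_card_fiber {A B : Type*} [Finite A] [Finite B] (φ : A → B) (c : ℕ)
    (h : ∀ b, Nat.card {a // φ a = b} = c) : Nat.card A = Nat.card B * c := by
  have := Fintype.ofFinite B
  rw [← Nat.card_congr (Equiv.sigmaFiberEquiv φ), Nat.card_sigma, Finset.sum_congr rfl fun b _ => h b]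
  simp

theorem card_succ_eq_ncard_mul {X : Type*} [Finite X] {f : X → X} {G : ℕ → ℕ}
    (hG : ∀ j x, Nat.card {y // f^[j] y = f^[j] x} = G j) {j : ℕ} {y : X}
    (hy : y ∈ Set.range f^[j + 1]) :
    G (j + 1) = {x | f x = y ∧ x ∈ Set.range f^[j]}.ncard * G j := by
  obtain ⟨x₀, rfl⟩ := hy
  rw [← hG (j + 1) x₀, ← Nat.card_coe_set_eq]
  refine card_eq_mul_of_card_fiber
    (fun y => ⟨f^[j] y.1, (iterate_succ_apply' f j y.1).symm.trans y.2, y.1, rfl⟩) _ ?_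
  · rintro ⟨_, hb, x, rfl⟩
    rw [← hG j x]
    refine Nat.card_congr ⟨fun a => ⟨a.1.1, congrArg Subtype.val a.2⟩,
      fun a => ⟨⟨a.1, ?_⟩, Subtype.ext a.2⟩, fun _ => rfl, fun _ => rfl⟩
    rw [iterate_succ_apply', a.2, hb]

theorem ncard_preimage_range {X : Type*} [Finite X] {f : X → X} {G : ℕ → ℕ}
    (hG : ∀ j x, Nat.card {y // f^[j] y = f^[j] x} = G j) {j : ℕ} {y : X}
    (hy : y ∈ Set.range f^[j + 1]) :
    {x | f x = y ∧ x ∈ Set.range f^[j]}.ncard = G (j + 1) / G j := by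
  have hpos : 0 < G j := by
    rw [← hG j y]
    have : Nonempty {z // f^[j] z = f^[j] y} := ⟨⟨y, rfl⟩⟩
    exact Nat.card_pos
  rw [card_succ_eq_ncard_mul hG hy, Nat.mul_div_cancel _ hpos]

theorem range_iterate_antitone {X : Type*} (f : X → X) : Antitone fun j => Set.range f^[j] :=
  antitone_nat_of_succ_le fun j => by
    rintro _ ⟨x, rfl⟩
    exact ⟨f x, (iterate_succ_apply f j x).symm⟩

theorem ncard_preimage_range_diff {X : Type*} [Finite X] {f : X → X} {G : ℕ → ℕ}
    (hG : ∀ j x, Nat.card {y // f^[j] y = f^[j] x} = G j) {j : ℕ} {y : X}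
    (hy : y ∈ Set.range f^[j + 2]) :
    {x | f x = y ∧ x ∈ Set.range f^[j] ∧ x ∉ Set.range f^[j + 1]}.ncard =
      G (j + 1) / G j - G (j + 2) / G (j + 1) := by
  rw [← ncard_preimage_range hG hy,
    ← ncard_preimage_range hG (range_iterate_antitone f (Nat.le_succ (j + 1)) hy),
    ← Set.ncard_sdiff]
  · congr 1
    ext x
    simp only [Set.mem_ofPred_eq, Set.mem_sdiff]
    tauto
  · exact fun x hx => ⟨hx.1, range_iterate_antitone f (Nat.le_succ j) hx.2⟩

theorem periodicPts_subset_range_iterate {X : Type*} (f : X → X) (j : ℕ) :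
    periodicPts f ⊆ Set.range f^[j] := fun x hx => by
  obtain ⟨y, -, hy⟩ := ((bijOn_periodicPts (f := f)).surjOn.iterate j) hx
  exact ⟨y, hy⟩

/-- Once the fibre sizes stop growing, `f` is injective, hence a permutation, on the iterated
images. -/
theorem range_iterate_subset_periodicPts {X : Type*} [Finite X] {f : X → X} {G : ℕ → ℕ}
    (hG : ∀ j x, Nat.card {y // f^[j] y = f^[j] x} = G j) {j : ℕ} (hj : G (j + 1) = G j) :
    Set.range f^[j] ⊆ periodicPts f := by
  let g : Set.range f^[j] → Set.range f^[j] := fun x =>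
    ⟨f x, by obtain ⟨_, y, rfl⟩ := x; exact ⟨f y, by rw [← iterate_succ_apply, iterate_succ_apply']⟩⟩
  have hg : Injective g := by
    rintro ⟨_, a, rfl⟩ ⟨_, b, rfl⟩ hab
    have hab' : f (f^[j] a) = f (f^[j] b) := congrArg Subtype.val hab
    -- the fibres of `f^[j]` and of `f^[j + 1]` through `b` have the same size
    have hsub : {y | f^[j] y = f^[j] b} ⊆ {y | f^[j + 1] y = f^[j + 1] b} := fun y hy => by
      rw [Set.mem_ofPred_eq, iterate_succ_apply', iterate_succ_apply', hy]
    have heq := Set.eq_of_subset_of_ncard_le hsub (by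
      rw [← Nat.card_coe_set_eq, ← Nat.card_coe_set_eq]
      exact (((hG (j + 1) b).trans hj).trans (hG j b).symm).le)
    have ha : a ∈ {y | f^[j + 1] y = f^[j + 1] b} := by
      rw [Set.mem_ofPred_eq, iterate_succ_apply', iterate_succ_apply', hab']
    rw [← heq] at ha
    exact Subtype.ext ha
  intro x hx
  obtain ⟨k, hk, h⟩ := hg.mem_periodicPts ⟨x, hx⟩
  have hval : ∀ i, ((g^[i] ⟨x, hx⟩ : Set.range f^[j]) : X) = f^[i] x := fun i => by
    induction i with
    | zero => rfl
    | succ i ih => rw [iterate_succ_apply', iterate_succ_apply', ← ih]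
  exact ⟨k, hk, (hval k).symm.trans (congrArg Subtype.val h)⟩

/-! ### The trees of a map all of whose iterates have fibres of constant size -/

/-- `IsTreeAt.join` for nonperiodic preimages sorted into classes `C₀` and `C i` of known sizes, with
the same tree at all members of a class. The index type is the one in `elemTree`. -/
theorem isTreeAt_join_sum {X : Type*} [Finite X] {f : X → X} {y : X} {a K : ℕ} {b : Fin K → ℕ}
    {T₀ : InTree} {T : Fin K → InTree} (C₀ : Set X) (C : Fin K → Set X) (h₀ : C₀.ncard = a)
    (hb : ∀ i, (C i).ncard = b i) (hd₀ : ∀ i, Disjoint C₀ (C i))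
    (hd : ∀ i j, i ≠ j → Disjoint (C i) (C j))
    (hmem : ∀ x, (x ∈ C₀ ∨ ∃ i, x ∈ C i) ↔ x ∉ periodicPts f ∧ f x = y)
    (hT₀ : ∀ x ∈ C₀, IsTreeAt f x T₀) (hT : ∀ i, ∀ x ∈ C i, IsTreeAt f x (T i)) :
    IsTreeAt f y (InTree.join
      (Sum.elim (fun _ : Fin a => T₀) (fun p : (Σ i : Fin K, Fin (b i)) => T p.1))) := by
  have E₀ : Fin a ≃ C₀ := (Finite.equivFinOfCardEq ((Nat.card_coe_set_eq C₀).trans h₀)).symm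
  have E : ∀ i, Fin (b i) ≃ C i := fun i =>
    (Finite.equivFinOfCardEq ((Nat.card_coe_set_eq (C i)).trans (hb i))).symm
  refine IsTreeAt.join (c := Sum.elim (fun i => (E₀ i : X)) (fun p => (E p.1 p.2 : X))) ?_ ?_ ?_
  · rintro (i | ⟨i, s⟩) (j | ⟨j, t⟩) hij
    · exact congrArg Sum.inl (E₀.injective (Subtype.ext hij))
    · change (E₀ i : X) = E j t at hij
      exact (Set.disjoint_left.1 (hd₀ j) (E₀ i).2 (hij ▸ (E j t).2)).elim
    · change (E i s : X) = E₀ j at hij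
      exact (Set.disjoint_left.1 (hd₀ i) (E₀ j).2 (hij ▸ (E i s).2)).elim
    · change (E i s : X) = E j t at hij
      have hh : i = j := by
        by_contra h
        exact Set.disjoint_left.1 (hd i j h) (E i s).2 (hij ▸ (E j t).2)
      subst hh
      rw [(E i).injective (Subtype.ext hij)]
  · intro x
    rw [← hmem]
    constructor
    · rintro ⟨i | ⟨i, s⟩, rfl⟩
      · exact Or.inl (E₀ i).2
      · exact Or.inr ⟨i, (E i s).2⟩
    · rintro (hx | ⟨i, hx⟩)
      · exact ⟨Sum.inl (E₀.symm ⟨x, hx⟩), by simp⟩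
      · exact ⟨Sum.inr ⟨i, (E i).symm ⟨x, hx⟩⟩, by simp⟩
  · rintro (i | ⟨i, s⟩)
    · exact hT₀ _ (E₀ i).2
    · exact hT i _ (E i s).2

/-- The level of a point is the largest `k` such that it is a `k`-fold iterated image; the tree at
a point of finite level `k` is `T_V^k`. -/
theorem isTreeAt_elemTreeLevel {X : Type*} [Finite X] {f : X → X} {G : ℕ → ℕ}
    (hG : ∀ j x, Nat.card {y // f^[j] y = f^[j] x} = G j) (V : List ℕ) (k : ℕ)
    (hV : ∀ i < k, entry V (i + 1) = G (i + 1) / G i) (y : X) (hy : y ∈ Set.range f^[k])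
    (hy' : y ∉ Set.range f^[k + 1]) : IsTreeAt f y (elemTreeLevel V k) := by
  induction k using Nat.strong_induction_on generalizing y with
  | _ k ih =>
  rcases k with _ | k
  · rw [elemTreeLevel]
    refine ⟨fun _ => y, rfl, fun _ _ _ => rfl, fun _ _ h => h.elim, fun _ h => (h rfl).elim, ?_⟩
    exact fun x _ _ h => (hy' ⟨x, h⟩).elim
  · rw [elemTreeLevel]
    have hnot : ∀ x, f x = y → x ∉ Set.range f^[k + 1] := by
      rintro _ hx ⟨z, rfl⟩
      exact hy' ⟨z, by rw [iterate_succ_apply', hx]⟩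
    have hdisj : ∀ i j, i < j → Disjoint
        {x | f x = y ∧ x ∈ Set.range f^[i] ∧ x ∉ Set.range f^[i + 1]}
        {x | f x = y ∧ x ∈ Set.range f^[j] ∧ x ∉ Set.range f^[j + 1]} := fun i j hij =>
      Set.disjoint_left.2 fun x hx hx' => hx.2.2 (range_iterate_antitone f hij hx'.2.1)
    refine isTreeAt_join_sum (T₀ := elemTreeLevel V k)
      (T := fun i => elemTreeLevel V i) (b := fun i => entry V (i + 1) - entry V (i + 2))
      {x | f x = y ∧ x ∈ Set.range f^[k] ∧ x ∉ Set.range f^[k + 1]}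
      (fun i => {x | f x = y ∧ x ∈ Set.range f^[(i : ℕ)] ∧ x ∉ Set.range f^[(i : ℕ) + 1]})
      ?_ ?_ ?_ ?_ ?_ ?_ ?_
    · rw [hV k k.lt_succ_self, ← ncard_preimage_range hG hy]
      congr 1
      ext x
      exact ⟨fun h => ⟨h.1, h.2.1⟩, fun h => ⟨h.1, h.2, hnot x h.1⟩⟩
    · intro i
      rw [hV i (by omega), hV (i + 1) (by omega), ncard_preimage_range_diff hG]
      exact range_iterate_antitone f (by omega) hy
    · exact fun i => (hdisj i k i.isLt).symm
    · intro i j hij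
      rcases lt_or_gt_of_ne (Fin.val_ne_of_ne hij) with h | h
      · exact hdisj i j h
      · exact (hdisj j i h).symm
    · intro x
      constructor
      · have hP : ∀ j ≤ k, x ∉ Set.range f^[j + 1] → x ∉ periodicPts f :=
          fun j _ h h' => h (periodicPts_subset_range_iterate f _ h')
        rintro (⟨h, -, h'⟩ | ⟨i, h, -, h'⟩)
        · exact ⟨hP k le_rfl h', h⟩
        · exact ⟨hP i i.isLt.le h', h⟩
      · rintro ⟨-, hx⟩
        classical
        have hex : ∃ j, x ∉ Set.range f^[j + 1] := ⟨k, hnot x hx⟩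
        have hle : Nat.find hex ≤ k := Nat.find_min' hex (hnot x hx)
        have hmem : x ∈ Set.range f^[Nat.find hex] := by
          rcases hj : Nat.find hex with _ | j
          · exact ⟨x, rfl⟩
          · exact not_not.1 (Nat.find_min hex (hj ▸ j.lt_succ_self))
        rcases hle.lt_or_eq with h | h
        · exact Or.inr ⟨⟨_, h⟩, hx, hmem, Nat.find_spec hex⟩
        · exact Or.inl ⟨hx, h ▸ hmem, hnot x hx⟩
    · exact fun x hx => ih k k.lt_succ_self (fun i hi => hV i (by omega)) x hx.2.1 hx.2.2
    · exact fun i x hx => ih i (by omega) (fun j hj => hV j (by omega)) x hx.2.1 hx.2.2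

/-- If the fibres of `f^[j]` have constant size `G j` and the quotients `G (j + 1) / G j` reach `1`
at the last entry of `V`, then the tree at each periodic point is `T_V`: its nonperiodic children
are the preimages of level less than `V.length - 1`. -/
theorem isTreeAt_elemTree {X : Type*} [Finite X] {f : X → X} {G : ℕ → ℕ}
    (hG : ∀ j x, Nat.card {y // f^[j] y = f^[j] x} = G j) (V : List ℕ) (D : ℕ)
    (hD : V.length = D + 1) (hV : ∀ i ≤ D, entry V (i + 1) = G (i + 1) / G i)
    (hone : G (D + 1) = G D) (y : X) (hy : y ∈ periodicPts f) : IsTreeAt f y (elemTree V) := by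
  have hGpos : 0 < G D := by
    rw [← hG D y]
    have : Nonempty {z // f^[D] z = f^[D] y} := ⟨⟨y, rfl⟩⟩
    exact Nat.card_pos
  have hP := range_iterate_subset_periodicPts hG hone
  have hyR := fun j => periodicPts_subset_range_iterate f j hy
  rw [elemTree, hD]
  have hdisj : ∀ i j, i < j → Disjoint
      {x | f x = y ∧ x ∈ Set.range f^[i] ∧ x ∉ Set.range f^[i + 1]}
      {x | f x = y ∧ x ∈ Set.range f^[j] ∧ x ∉ Set.range f^[j + 1]} := fun i j hij =>
    Set.disjoint_left.2 fun x hx hx' => hx.2.2 (range_iterate_antitone f hij hx'.2.1)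
  refine isTreeAt_join_sum (T₀ := elemTreeLevel V D) (K := D)
    (T := fun i => elemTreeLevel V i) (b := fun i => entry V (i + 1) - entry V (i + 2)) ∅
    (fun i => {x | f x = y ∧ x ∈ Set.range f^[(i : ℕ)] ∧ x ∉ Set.range f^[(i : ℕ) + 1]})
    ?_ ?_ ?_ ?_ ?_ ?_ ?_
  · rw [hV D le_rfl, hone, Nat.div_self hGpos, Set.ncard_empty]
  · intro i
    rw [hV i (by omega), hV (i + 1) (by omega), ncard_preimage_range_diff hG (hyR _)]
  · exact fun i => Set.empty_disjoint _
  · intro i j hij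
    rcases lt_or_gt_of_ne (Fin.val_ne_of_ne hij) with h | h
    · exact hdisj i j h
    · exact (hdisj j i h).symm
  · intro x
    constructor
    · rintro (h | ⟨i, h, -, h'⟩)
      · exact h.elim
      · exact ⟨fun hx => h' (periodicPts_subset_range_iterate f _ hx), h⟩
    · rintro ⟨hx, hxy⟩
      classical
      have hex : ∃ j, x ∉ Set.range f^[j] := ⟨D, fun h => hx (hP h)⟩
      obtain ⟨j, hj⟩ : ∃ j, Nat.find hex = j + 1 := Nat.exists_eq_succ_of_ne_zero fun h =>
        Nat.find_spec hex (h ▸ ⟨x, rfl⟩)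
      have hle : Nat.find hex ≤ D := Nat.find_min' hex fun h => hx (hP h)
      exact Or.inr ⟨⟨j, by omega⟩, hxy, not_not.1 (Nat.find_min hex (m := j) (by omega)),
        hj ▸ Nat.find_spec hex⟩
  · exact fun x hx => hx.elim
  · exact fun i x hx => isTreeAt_elemTreeLevel hG V i (fun j hj => hV j (by omega)) x hx.2.1 hx.2.2

/-! ### Cycles -/

/-- A map all of whose points have minimal period `L` is a disjoint union of `L`-cycles. -/
theorem exists_equiv_cycles {A : Type*} [Finite A] (f : A → A) (L : ℕ) (hL : 0 < L)
    (hper : ∀ x, minimalPeriod f x = L) : ∃ c : ℕ, Nat.card A = c * L ∧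
      ∃ e : (Σ _ : Fin c, ZMod L) ≃ A, ∀ p, e ⟨p.1, p.2 + 1⟩ = f (e p) := by
  have : NeZero L := ⟨hL.ne'⟩
  let st : Setoid A :=
    { r := fun x y => ∃ j, f^[j] x = y
      iseqv := by
        refine ⟨fun x => ⟨0, rfl⟩, ?_, ?_⟩
        · rintro x _ ⟨j, rfl⟩
          refine ⟨(L - 1) * j, ?_⟩
          have h : f^[L * j] x = x :=
            ((hper x ▸ isPeriodicPt_minimalPeriod f x : IsPeriodicPt f L x).mul_const j)
          rw [← iterate_add_apply, ← Nat.succ_mul, Nat.succ_eq_add_one, Nat.sub_add_cancel hL, h]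
        · rintro x _ _ ⟨i, rfl⟩ ⟨j, rfl⟩
          exact ⟨j + i, iterate_add_apply f j i x⟩ }
  let Φ : Quotient st × ZMod L → A := fun p => f^[p.2.val] p.1.out
  have hΦ : Bijective Φ := by
    constructor
    · rintro ⟨Q, z⟩ ⟨Q', w⟩ h
      change f^[z.val] Q.out = f^[w.val] Q'.out at h
      have hQ : Q = Q' := by
        rw [← Q.out_eq, ← Q'.out_eq]
        have h1 : st.r Q.out (f^[z.val] Q.out) := ⟨_, rfl⟩
        have h2 : st.r Q'.out (f^[z.val] Q.out) := ⟨_, h.symm⟩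
        exact Quotient.sound (st.trans h1 (st.symm h2))
      subst hQ
      have hz := (iterate_eq_iterate_iff_of_lt_minimalPeriod
        ((hper Q.out).symm ▸ z.val_lt) ((hper Q.out).symm ▸ w.val_lt)).1 h
      exact congrArg (Q, ·) (ZMod.val_injective L hz)
    · intro x
      obtain ⟨j, hj⟩ : st.r (⟦x⟧ : Quotient st).out x := Quotient.exact (Quotient.out_eq _)
      refine ⟨(⟦x⟧, (j : ZMod L)), ?_⟩
      change f^[(j : ZMod L).val] _ = x
      rw [ZMod.val_natCast]
      have h := iterate_mod_minimalPeriod_eq (f := f) (x := (⟦x⟧ : Quotient st).out) (n := j)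
      rw [hper] at h
      rw [h, hj]
  have hstep : ∀ Q z, Φ (Q, z + 1) = f (Φ (Q, z)) := by
    intro Q z
    change f^[(z + 1).val] _ = f (f^[z.val] _)
    have h1 : (z + 1).val = (z.val + 1) % L := by
      rw [← ZMod.val_natCast, Nat.cast_add, ZMod.natCast_zmod_val, Nat.cast_one]
    have h := iterate_mod_minimalPeriod_eq (f := f) (x := Q.out) (n := z.val + 1)
    rw [hper] at h
    rw [h1, h, iterate_succ_apply']
  have E : Fin (Nat.card (Quotient st)) ≃ Quotient st := (Finite.equivFin _).symm
  refine ⟨Nat.card (Quotient st), ?_,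
    ((Equiv.sigmaEquivProd _ _).trans (E.prodCongr (Equiv.refl _))).trans (Equiv.ofBijective Φ hΦ),
    fun p => hstep (E p.1) p.2⟩
  rw [← Nat.card_congr (Equiv.ofBijective Φ hΦ), Nat.card_prod, Nat.card_zmod]

theorem minimalPeriod_subtype {X : Type*} {f : X → X} {s : Set X} (g : s → s)
    (hg : ∀ x, (g x : X) = f x) (x : s) : minimalPeriod g x = minimalPeriod f x := by
  have hval : ∀ i, ((g^[i] x : s) : X) = f^[i] x := fun i => by
    induction i with
    | zero => rfl
    | succ i ih => rw [iterate_succ_apply', iterate_succ_apply', hg, ih]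
  refine minimalPeriod_eq_minimalPeriod_iff.2 fun i => ?_
  exact ⟨fun h => (hval i).symm.trans (congrArg Subtype.val h),
    fun h => Subtype.ext ((hval i).trans h)⟩

theorem exists_ncard_eq_mul {X : Type*} [Finite X] (f : X → X) (A : Set X) (L : ℕ) (hL : 0 < L)
    (hmaps : ∀ x ∈ A, f x ∈ A) (hper : ∀ x ∈ A, minimalPeriod f x = L) :
    ∃ c, A.ncard = c * L := by
  obtain ⟨c, hc, -⟩ := exists_equiv_cycles (fun x : A => (⟨f x, hmaps x x.2⟩ : A)) L hL
    fun x => (minimalPeriod_subtype _ (fun _ => rfl) x).trans (hper x x.2)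
  exact ⟨c, (Nat.card_coe_set_eq A).symm.trans hc⟩

/-- The graph of a map with the same tree at every periodic point is determined by the number of
its cycles of each kind. Here `A i u` is the set of periodic points of kind `(i, u)`. -/
theorem functionalGraph_iso_disjointUnion_cyc {X : Type*} [Finite X] (f : X → X) (T : InTree)
    (hT : ∀ p ∈ periodicPts f, IsTreeAt f p T) {ι : Type*} {U : ι → Type*} (len c : ∀ i, U i → ℕ)
    (A : ∀ i, U i → Set X) (hpos : ∀ i u, 0 < len i u) (hmaps : ∀ i u, ∀ x ∈ A i u, f x ∈ A i u)
    (hper : ∀ i u, ∀ x ∈ A i u, minimalPeriod f x = len i u)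
    (hcov : ∀ x ∈ periodicPts f, ∃ i u, x ∈ A i u)
    (hdisj : ∀ p p' : Σ i, U i, ∀ x, x ∈ A p.1 p.2 → x ∈ A p'.1 p'.2 → p = p')
    (hcard : ∀ i u, (A i u).ncard = c i u * len i u) :
    Iso (functionalGraph f) (disjointUnion fun i => disjointUnion fun u =>
      copies (c i u) (cyc (len i u) T)) := by
  have he : ∀ i u, ∃ e : (Σ _ : Fin (c i u), ZMod (len i u)) ≃ A i u,
      ∀ p, (e ⟨p.1, p.2 + 1⟩ : X) = f (e p) := by
    intro i u
    obtain ⟨c', hc', e, he⟩ := exists_equiv_cycles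
      (fun x : A i u => (⟨f x, hmaps i u x x.2⟩ : A i u)) (len i u) (hpos i u)
      fun x => (minimalPeriod_subtype _ (fun _ => rfl) x).trans (hper i u x x.2)
    obtain rfl : c' = c i u := Nat.eq_of_mul_eq_mul_right (hpos i u)
      (by rw [← hc', ← hcard, Nat.card_coe_set_eq])
    exact ⟨e, fun p => congrArg Subtype.val (he p)⟩
  choose e he using he
  let E : (Σ i, Σ u, Σ _ : Fin (c i u), ZMod (len i u)) → periodicPts f := fun p =>
    ⟨e p.1 p.2.1 p.2.2, minimalPeriod_pos_iff_mem_periodicPts.1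
      ((hper _ _ _ (e p.1 p.2.1 p.2.2).2).symm ▸ hpos _ _)⟩
  have hE : Bijective E := by
    constructor
    · rintro ⟨i, u, p⟩ ⟨j, v, p'⟩ h
      have h' : (e i u p : X) = e j v p' := congrArg Subtype.val h
      have hh := hdisj ⟨i, u⟩ ⟨j, v⟩ _ (e i u p).2 (h' ▸ (e j v p').2)
      cases hh
      rw [(e i u).injective (Subtype.ext h')]
    · rintro ⟨x, hx⟩
      obtain ⟨i, u, hxA⟩ := hcov x hx
      exact ⟨⟨i, u, (e i u).symm ⟨x, hxA⟩⟩, Subtype.ext (by simp [E])⟩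
  refine (functionalGraph_iso_treesOver f T hT (fun p => ⟨p.1, p.2.1, p.2.2.1, p.2.2.2 + 1⟩)
    (Equiv.ofBijective E hE) fun p => he p.1 p.2.1 p.2.2).trans ?_
  refine (disjointUnion_treesOver (fun i (p : Σ u, Σ _ : Fin (c i u), ZMod (len i u)) =>
    ⟨p.1, p.2.1, p.2.2 + 1⟩) T).trans (Iso.disjointUnion fun i => ?_)
  refine (disjointUnion_treesOver (fun u (p : Σ _ : Fin (c i u), ZMod (len i u)) =>
    ⟨p.1, p.2 + 1⟩) T).trans (Iso.disjointUnion fun u => ?_)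
  exact disjointUnion_treesOver (fun _ (z : ZMod (len i u)) => z + 1) T

/-- What an isomorphism with `Cyc(k)` says about the map; `k = 0` would make `S` infinite. -/
theorem Iso.cyc_single {Z : Type*} {ψ : Z → Z} {S : Set Z} {k : ℕ} [Finite S]
    (hS : Iso (induce (functionalGraph ψ) S) (cyc k InTree.single)) :
    0 < k ∧ (∀ s ∈ S, ψ s ∈ S) ∧ Nat.card S = k ∧ (∀ s ∈ S, minimalPeriod ψ s = k) ∧
      ∀ s ∈ S, ∀ t ∈ S, ∃ j, ψ^[j] s = t := by
  obtain ⟨e⟩ := hS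
  have hk : k ≠ 0 := by
    rintro rfl
    exact not_injective_infinite_finite (fun z : ZMod 0 => e.symm (z, ())) fun z w h =>
      congrArg Prod.fst (e.symm.injective h)
  have hstep : ∀ a : S, ψ a = (e.symm ((e a).1 + 1, ()) : S) := fun a => by
    have h : (cyc k InTree.single).Adj (e a) (e (e.symm ((e a).1 + 1, ()))) := by
      rw [RelIso.apply_symm_apply]
      exact Or.inr ⟨rfl, rfl, rfl⟩
    exact e.map_rel_iff.1 h
  have hmaps : ∀ s ∈ S, ψ s ∈ S := fun s hs => hstep ⟨s, hs⟩ ▸ Subtype.coe_prop _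
  have hiter : ∀ (a : S) j, ψ^[j] a = (e.symm ((e a).1 + (j : ZMod k), ()) : S) := fun a j => by
    induction j with
    | zero => rw [Nat.cast_zero, add_zero]; exact congrArg Subtype.val (e.symm_apply_apply a).symm
    | succ j ih =>
      rw [iterate_succ_apply', ih, hstep, RelIso.apply_symm_apply, Nat.cast_add, Nat.cast_one,
        add_assoc]
  have : NeZero k := ⟨hk⟩
  refine ⟨Nat.pos_of_ne_zero hk, hmaps, ?_, fun s hs => ?_, fun s hs t ht => ?_⟩
  · have hU : Nat.card InTree.single.V = 1 := Nat.card_unique (α := Unit)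
    rw [Nat.card_congr e.toEquiv, Nat.card_prod, Nat.card_zmod, hU, mul_one]
  · have hper : ∀ j, IsPeriodicPt ψ j s ↔ k ∣ j := fun j => by
      rw [IsPeriodicPt, IsFixedPt, show ψ^[j] s = _ from hiter ⟨s, hs⟩ j,
        ← ZMod.natCast_eq_zero_iff]
      constructor
      · intro h
        have h' : e.symm ((e ⟨s, hs⟩).1 + (j : ZMod k), ()) = ⟨s, hs⟩ := Subtype.ext h
        rw [RelIso.symm_apply_eq] at h'
        exact add_eq_left.1 (congrArg Prod.fst h')
      · intro h
        rw [h, add_zero]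
        exact congrArg Subtype.val (e.symm_apply_apply ⟨s, hs⟩)
    exact Nat.dvd_antisymm ((hper k).2 dvd_rfl).minimalPeriod_dvd
      ((hper _).1 (isPeriodicPt_minimalPeriod ψ s))
  · refine ⟨((e ⟨t, ht⟩).1 - (e ⟨s, hs⟩).1 : ZMod k).val, ?_⟩
    rw [show ψ^[_] s = _ from hiter ⟨s, hs⟩ _, ZMod.natCast_zmod_val, add_sub_cancel]
    exact congrArg Subtype.val (e.symm_apply_apply ⟨t, ht⟩)

/-! ### Arithmetic: coprime parts, iterated gcds, Möbius inversion -/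

theorem coprimePart_spec {n N : ℕ} (hN : 0 < N) :
    coprimePart n N ∣ N ∧ Nat.Coprime (coprimePart n N) n ∧
      ∀ d, d ∣ N → Nat.Coprime d n → d ∣ coprimePart n N := by
  have hmem : coprimePart n N ∈ N.divisors.filter fun d => Nat.Coprime d n := by
    obtain ⟨d, hd, h⟩ := Finset.exists_mem_eq_sup (N.divisors.filter fun d => Nat.Coprime d n)
      ⟨1, by simp [hN.ne']⟩ id
    rw [coprimePart, h]
    exact hd
  rw [Finset.mem_filter, Nat.mem_divisors] at hmem
  refine ⟨hmem.1.1, hmem.2, fun d hd hdn => ?_⟩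
  -- the least common multiple of `d` and the maximum is again a divisor coprime to `n`
  have hl : Nat.lcm d (coprimePart n N) ≤ coprimePart n N := by
    refine Finset.le_sup (f := id) (Finset.mem_filter.2 ⟨Nat.mem_divisors.2
      ⟨Nat.lcm_dvd hd hmem.1.1, hN.ne'⟩, ?_⟩)
    exact (hdn.mul_left hmem.2).coprime_dvd_left (Nat.lcm_dvd_mul _ _)
  have hpos : 0 < coprimePart n N := Nat.pos_of_dvd_of_pos hmem.1.1 hN
  have heq : Nat.lcm d (coprimePart n N) = coprimePart n N :=
    hl.antisymm (Nat.le_of_dvd (Nat.lcm_pos (Nat.pos_of_dvd_of_pos hd hN) hpos)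
      (Nat.dvd_lcm_right _ _))
  exact heq ▸ Nat.dvd_lcm_left _ _

theorem gcd_pow_dvd_gcd_pow_succ (n v j : ℕ) : Nat.gcd (n ^ j) v ∣ Nat.gcd (n ^ (j + 1)) v :=
  Nat.gcd_dvd_gcd_of_dvd_left v (pow_dvd_pow n j.le_succ)

theorem exists_gcdEntry_eq_one (n : ℕ) {v : ℕ} (hv : 0 < v) : ∃ s, 0 < s ∧ gcdEntry n v s = 1 := by
  by_contra! h
  have hgrow : ∀ j, 2 ^ j ≤ Nat.gcd (n ^ j) v := by
    intro j
    induction j with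
    | zero => simp
    | succ j ih =>
      obtain ⟨c, hc⟩ := gcd_pow_dvd_gcd_pow_succ n v j
      have hpos : 0 < Nat.gcd (n ^ j) v := Nat.gcd_pos_of_pos_right _ hv
      have hpos' : 0 < Nat.gcd (n ^ (j + 1)) v := Nat.gcd_pos_of_pos_right _ hv
      have h1 : gcdEntry n v (j + 1) = c := by
        rw [gcdEntry, hc, Nat.add_sub_cancel, Nat.mul_div_cancel_left _ hpos]
      have hc1 := h1 ▸ h (j + 1) j.succ_pos
      have hc0 : c ≠ 0 := by
        rintro rfl
        omega
      rw [hc, pow_succ]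
      exact Nat.mul_le_mul ih (by omega)
  exact absurd ((hgrow v).trans (Nat.gcd_le_right _ hv)) (not_le.2 v.lt_two_pow_self)

theorem iterGcd_spec (n : ℕ) {v : ℕ} (hv : 0 < v) : ∃ D, (iterGcd n v).length = D + 1 ∧
    (∀ i ≤ D, entry (iterGcd n v) (i + 1) = Nat.gcd (n ^ (i + 1)) v / Nat.gcd (n ^ i) v) ∧
    Nat.gcd (n ^ (D + 1)) v = Nat.gcd (n ^ D) v := by
  have hs := Nat.sInf_mem (s := {s | 0 < s ∧ gcdEntry n v s = 1}) (exists_gcdEntry_eq_one n hv)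
  obtain ⟨D, hD⟩ := Nat.exists_eq_succ_of_ne_zero hs.1.ne'
  have hlen : (iterGcd n v).length = D + 1 := by simp [iterGcd, hD]
  refine ⟨D, hlen, fun i hi => ?_, ?_⟩
  · have hi' : i < (iterGcd n v).length := by omega
    rw [entry, Nat.add_sub_cancel, List.getD_eq_getElem _ _ hi']
    simp [iterGcd, gcdEntry]
  · have h1 := hs.2
    rw [hD, gcdEntry, Nat.succ_sub_one] at h1
    exact Nat.eq_of_dvd_of_div_eq_one (gcd_pow_dvd_gcd_pow_succ n v D) h1 |>.symm

/-- Möbius inversion, with the sum over divisors. -/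
theorem eq_sum_moebius_of_sum_divisors {a b : ℕ → ℕ}
    (h : ∀ u > 0, ∑ d ∈ u.divisors, a d = b u) {u : ℕ} (hu : 0 < u) :
    (a u : ℚ) = ∑ d ∈ u.divisors, (ArithmeticFunction.moebius (u / d) : ℚ) * (b d : ℚ) := by
  have := (ArithmeticFunction.sum_eq_iff_sum_mul_moebius_eq
    (f := fun d => (a d : ℚ)) (g := fun d => (b d : ℚ))).1
      (fun u hu => by rw [← h u hu]; push_cast; rfl) u hu
  rw [← this, Nat.sum_divisorsAntidiagonal'
    (fun x y => (ArithmeticFunction.moebius x : ℚ) * (b y : ℚ))]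

/-! ### Maps `x ↦ x ^ n * H (x ^ M)` -/

theorem iterate_pow_eq {F : Type*} [Field F] {n M : ℕ} {H f ψ : F → F}
    (hf : ∀ x, f x = x ^ n * H (x ^ M)) (hψ : ∀ s, ψ s = s ^ n * H s ^ M) (j : ℕ) (x : F) :
    (f^[j] x) ^ M = ψ^[j] (x ^ M) := by
  have h : Semiconj (· ^ M) f ψ := fun x => by
    simp only [hf, hψ, mul_pow]
    rw [← pow_mul, ← pow_mul, mul_comm n M]
  exact h.iterate_right j x

theorem iterate_mul_eq {F : Type*} [Field F] {n M : ℕ} {H f : F → F}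
    (hf : ∀ x, f x = x ^ n * H (x ^ M)) {ζ : F} (hζ : ζ ^ M = 1) (j : ℕ) (x : F) :
    f^[j] (ζ * x) = ζ ^ n ^ j * f^[j] x := by
  induction j with
  | zero => simp
  | succ j ih =>
    have h1 : (ζ ^ n ^ j) ^ M = 1 := by rw [← pow_mul, mul_comm, pow_mul, hζ, one_pow]
    rw [iterate_succ_apply', iterate_succ_apply', ih, hf, hf, mul_pow, mul_pow (_ ^ _) _ M, h1,
      one_mul, ← pow_mul, ← pow_succ, mul_assoc]

theorem iterate_eq_prod {F : Type*} [Field F] {n M : ℕ} {H f ψ : F → F}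
    (hf : ∀ x, f x = x ^ n * H (x ^ M)) (hψ : ∀ s, ψ s = s ^ n * H s ^ M) (j : ℕ) (x : F) :
    f^[j] x = (∏ i ∈ Finset.range j, H (ψ^[i] (x ^ M)) ^ n ^ (j - i - 1)) * x ^ n ^ j := by
  induction j with
  | zero => simp
  | succ j ih =>
    rw [iterate_succ_apply', hf, iterate_pow_eq hf hψ, ih, Finset.prod_range_succ, mul_pow,
      ← Finset.prod_pow, ← pow_mul, ← pow_succ]
    have : ∀ i ∈ Finset.range j, (H (ψ^[i] (x ^ M)) ^ n ^ (j - i - 1)) ^ n =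
        H (ψ^[i] (x ^ M)) ^ n ^ (j + 1 - i - 1) := fun i hi => by
      rw [← pow_mul, ← pow_succ]
      congr 2
      have := Finset.mem_range.1 hi
      omega
    rw [Finset.prod_congr rfl this, Nat.add_sub_cancel_left, Nat.sub_self, pow_zero, pow_one]
    ring

/-- On a fibre of `x ↦ x ^ M` that `f^[k]` preserves, iterating `f^[k]` multiplies `x` by a
geometric power of the ratio `f^[k] x / x`. -/
theorem iterate_mul_eq_geom {F : Type*} [Field F] {n M : ℕ} {H f : F → F}
    (hf : ∀ x, f x = x ^ n * H (x ^ M)) {k : ℕ} {x z : F} (hz : z ^ M = 1)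
    (hx : f^[k] x = z * x) (d : ℕ) :
    f^[k * d] x = z ^ (∑ j ∈ Finset.range d, (n ^ k) ^ j) * x := by
  induction d with
  | zero => simp
  | succ d ih =>
    have h1 : (z ^ (∑ j ∈ Finset.range d, (n ^ k) ^ j)) ^ M = 1 := by
      rw [← pow_mul, mul_comm, pow_mul, hz, one_pow]
    rw [Nat.mul_succ, Nat.add_comm, iterate_add_apply, ih, iterate_mul_eq hf h1, hx, ← mul_assoc,
      ← pow_mul, ← pow_succ, geom_sum_succ, mul_comm (n ^ k)]

theorem ncard_pow_eq_one {F : Type*} [Field F] [Finite F] {a : ℕ} (b : ℕ)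
    (ha : a ∣ Nat.card F - 1) :
    {ζ : F | ζ ^ a = 1 ∧ ζ ^ b = 1}.ncard = Nat.gcd a b := by
  have hcard : Nat.card Fˣ = Nat.card F - 1 := Nat.card_units F
  have hq : 0 < Nat.card Fˣ := Nat.card_pos
  have ha0 : 0 < a := Nat.pos_of_dvd_of_pos ha (hcard ▸ hq)
  have hg : 0 < Nat.gcd a b := Nat.gcd_pos_of_pos_left _ ha0
  have himg : {ζ : F | ζ ^ a = 1 ∧ ζ ^ b = 1} =
      (fun ζ : Fˣ => (ζ : F)) '' ((powMonoidHom (Nat.gcd a b) : Fˣ →* Fˣ).ker : Set Fˣ) := by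
    ext ζ
    constructor
    · intro h
      have h := pow_gcd_eq_one.2 h
      have h0 : ζ ≠ 0 := by
        rintro rfl
        rw [zero_pow hg.ne'] at h
        exact zero_ne_one h
      refine ⟨Units.mk0 ζ h0, ?_, rfl⟩
      rw [SetLike.mem_coe, MonoidHom.mem_ker, powMonoidHom_apply]
      exact Units.ext h
    · rintro ⟨ζ, h, rfl⟩
      rw [SetLike.mem_coe, MonoidHom.mem_ker, powMonoidHom_apply] at h
      exact pow_gcd_eq_one.1 (congrArg Units.val h)
  rw [himg, Set.ncard_image_of_injective _ Units.val_injective, ← Nat.card_coe_set_eq]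
  change Nat.card (powMonoidHom (Nat.gcd a b) : Fˣ →* Fˣ).ker = _
  rw [IsCyclic.card_powMonoidHom_ker, hcard]
  exact Nat.gcd_eq_right ((Nat.gcd_dvd_left a b).trans ha)

/-- The solutions of `x ^ M = x₀ ^ M`, `f^[j] x = f^[j] x₀`. -/
theorem ncard_iterate_fiber {F : Type*} [Field F] [Finite F] {n M : ℕ} {H f : F → F}
    (hf : ∀ x, f x = x ^ n * H (x ^ M)) (hM : M ∣ Nat.card F - 1) (j : ℕ) {x₀ : F} (hx₀ : x₀ ≠ 0)
    (hx₀' : f^[j] x₀ ≠ 0) :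
    {x : F | x ^ M = x₀ ^ M ∧ f^[j] x = f^[j] x₀}.ncard = Nat.gcd (n ^ j) M := by
  rw [Nat.gcd_comm, ← ncard_pow_eq_one (F := F) (n ^ j) hM,
    ← Set.ncard_image_of_injective {ζ : F | ζ ^ M = 1 ∧ ζ ^ n ^ j = 1} (mul_left_injective₀ hx₀)]
  congr 1
  ext x
  simp only [Set.mem_image, Set.mem_ofPred_eq]
  constructor
  · rintro ⟨h1, h2⟩
    have hζ : (x / x₀) ^ M = 1 := by rw [div_pow, h1, div_self (pow_ne_zero _ hx₀)]
    have hx : x / x₀ * x₀ = x := div_mul_cancel₀ x hx₀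
    refine ⟨x / x₀, ⟨hζ, ?_⟩, hx⟩
    have := iterate_mul_eq hf hζ j x₀
    rw [hx, h2] at this
    exact (mul_eq_right₀ hx₀').1 this.symm
  · rintro ⟨ζ, ⟨h1, h2⟩, rfl⟩
    rw [mul_pow, h1, one_mul, iterate_mul_eq hf h1, h2, one_mul]
    exact ⟨rfl, rfl⟩

/-- The fixed points of `f^[j]` in a fibre of `x ↦ x ^ M`, if there are any. -/
theorem ncard_fixed_fiber {F : Type*} [Field F] [Finite F] {n M : ℕ} {H f : F → F}
    (hn : 0 < n) (hf : ∀ x, f x = x ^ n * H (x ^ M)) (hM : M ∣ Nat.card F - 1) (j : ℕ) {x₀ : F}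
    (hx₀ : x₀ ≠ 0) (hfix : f^[j] x₀ = x₀) :
    {x : F | x ^ M = x₀ ^ M ∧ f^[j] x = x}.ncard = Nat.gcd M (n ^ j - 1) := by
  rw [← ncard_pow_eq_one (F := F) (n ^ j - 1) hM,
    ← Set.ncard_image_of_injective {ζ : F | ζ ^ M = 1 ∧ ζ ^ (n ^ j - 1) = 1}
      (mul_left_injective₀ hx₀)]
  have hpow : ∀ ζ : F, ζ ^ n ^ j = ζ ^ (n ^ j - 1) * ζ := fun ζ => by
    rw [← pow_succ, Nat.sub_add_cancel (Nat.pow_pos hn)]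
  congr 1
  ext x
  simp only [Set.mem_image, Set.mem_ofPred_eq]
  constructor
  · rintro ⟨h1, h2⟩
    have hζ : (x / x₀) ^ M = 1 := by rw [div_pow, h1, div_self (pow_ne_zero _ hx₀)]
    have hx : x / x₀ * x₀ = x := div_mul_cancel₀ x hx₀
    refine ⟨x / x₀, ⟨hζ, ?_⟩, hx⟩
    have hζ0 : x / x₀ ≠ 0 := by
      intro h0
      have hM0 : M ≠ 0 := by
        rintro rfl
        have h1 : Nat.card F - 1 = 0 := Nat.eq_zero_of_zero_dvd hM
        have h2 : 1 < Nat.card F := Finite.one_lt_card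
        omega
      rw [h0, zero_pow hM0] at hζ
      exact zero_ne_one hζ
    have := iterate_mul_eq hf hζ j x₀
    rw [hx, h2, hfix, hpow, mul_assoc, hx] at this
    have hx0 : x ≠ 0 := fun h => hζ0 (by rw [h, zero_div])
    exact (mul_eq_right₀ hx0).1 this.symm
  · rintro ⟨ζ, ⟨h1, h2⟩, rfl⟩
    rw [mul_pow, h1, one_mul, iterate_mul_eq hf h1, hpow, h2, one_mul, hfix]
    exact ⟨rfl, rfl⟩

/-! ### Counting periodic points -/

theorem sum_ncard_minimalPeriod {X : Type*} [Finite X] (f : X → X) (B : Set X) {k : ℕ}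
    (hk : 0 < k) (hdvd : ∀ x ∈ B, k ∣ minimalPeriod f x) {u : ℕ} (hu : 0 < u) :
    ∑ d ∈ u.divisors, {x | x ∈ B ∧ minimalPeriod f x = k * d}.ncard =
      {x | x ∈ B ∧ f^[k * u] x = x}.ncard := by
  classical
  have := Fintype.ofFinite X
  have hmem : ∀ x, f^[k * u] x = x ↔ minimalPeriod f x ∣ k * u := fun x =>
    isPeriodicPt_iff_minimalPeriod_dvd
  simp only [Set.ncard_eq_toFinset_card']
  rw [Finset.card_eq_sum_card_fiberwise (f := fun x => minimalPeriod f x / k) (t := u.divisors)]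
  · refine Finset.sum_congr rfl fun d hd => congrArg Finset.card ?_
    ext x
    simp only [Set.mem_toFinset, Set.mem_ofPred_eq, Finset.mem_filter]
    constructor
    · rintro ⟨hx, h⟩
      refine ⟨⟨hx, (hmem x).2 (h ▸ Nat.mul_dvd_mul_left k (Nat.dvd_of_mem_divisors hd))⟩, ?_⟩
      rw [h, Nat.mul_div_cancel_left _ hk]
    · rintro ⟨⟨hx, -⟩, h⟩
      exact ⟨hx, h ▸ (Nat.mul_div_cancel' (hdvd x hx)).symm⟩
  · intro x hx
    simp only [Set.coe_toFinset, Set.mem_ofPred_eq] at hx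
    obtain ⟨c, hc⟩ := hdvd x hx.1
    have h := (hmem x).1 hx.2
    rw [hc] at h
    simp only [Finset.mem_coe, Nat.mem_divisors, hc, Nat.mul_div_cancel_left _ hk]
    exact ⟨Nat.dvd_of_mul_dvd_mul_left hk h, hu.ne'⟩

/-- Over a cycle `S` of the map that `f` induces on the values of `p`, every fibre of `p` has the
same number of fixed points of `f^[L]`, so that one fibre determines the total. -/
theorem ncard_fixed_over_cycle {X Y : Type*} [Finite X] {f : X → X} {ψ : Y → Y} {p : X → Y}
    (hp : Semiconj p f ψ) {S : Set Y} [Finite S] (hS : ∀ s ∈ S, ∀ t ∈ S, ∃ j, ψ^[j] s = t) {L : ℕ}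
    (hL : 0 < L) {ξ : Y} (hξ : ξ ∈ S) :
    {x | p x ∈ S ∧ f^[L] x = x}.ncard = Nat.card S * {x | p x = ξ ∧ f^[L] x = x}.ncard := by
  have hle : ∀ s ∈ S, ∀ t ∈ S, {x | p x = s ∧ f^[L] x = x}.ncard ≤
      {x | p x = t ∧ f^[L] x = x}.ncard := by
    intro s hs t ht
    obtain ⟨j, hj⟩ := hS s hs t ht
    refine Set.ncard_le_ncard_of_injOn f^[j] ?_ ?_
    · rintro x ⟨hx, hfix⟩
      refine ⟨?_, ?_⟩
      · rw [← hj, ← hx]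
        exact hp.iterate_right j x
      · rw [← iterate_add_apply, Nat.add_comm, iterate_add_apply, hfix]
    · refine ((bijOn_periodicPts (f := f)).injOn.iterate (bijOn_periodicPts (f := f)).mapsTo j).mono
        fun x hx => mk_mem_periodicPts hL hx.2
  rw [← Nat.card_coe_set_eq, card_eq_mul_of_card_fiber
    (fun x : {x | p x ∈ S ∧ f^[L] x = x} => (⟨p x, x.2.1⟩ : S))
    {x | p x = ξ ∧ f^[L] x = x}.ncard]
  rintro ⟨s, hs⟩
  rw [(hle ξ hξ s hs).antisymm (hle s hs ξ hξ), ← Nat.card_coe_set_eq]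
  exact Nat.card_congr ⟨fun x => ⟨x.1.1, congrArg Subtype.val x.2, x.1.2.2⟩,
    fun x => ⟨⟨x.1, x.2.1.symm ▸ hs, x.2.2⟩, Subtype.ext x.2.1⟩, fun _ => rfl, fun _ => rfl⟩

theorem exists_dvd_sub_and_dvd_iff {M m A B ℓ r : ℤ} :
    (∃ e, m ∣ e - r ∧ M * m ∣ ℓ * A + e * B) ↔
      (Int.gcd (M * m) (B * m) : ℤ) ∣ ℓ * A + r * B := by
  rw [Int.coe_gcd, gcd_dvd_iff_exists]
  constructor
  · rintro ⟨e, ⟨s, hs⟩, y, hy⟩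
    exact ⟨y, -s, by linear_combination hy - B * hs⟩
  · rintro ⟨y, s, h⟩
    exact ⟨r - m * s, ⟨-s, by ring⟩, y, by linear_combination h⟩

/-- In the fibre over `ξ = α ^ (M * r)`, the fixed points of `f^[k * d]` are the `α ^ e` with
`e ≡ r` modulo `m` that satisfy a linear congruence modulo `q - 1`; it is solvable exactly under
the divisibility condition in `tau`. -/
theorem ncard_fixed_fiber_eq_tau {F : Type*} [Field F] [Finite F] {q m n M k : ℕ}
    (hq : Nat.card F = q) (hm : m ∣ q - 1) (hM : M = (q - 1) / m) (hn : 2 ≤ n) (hk : 0 < k)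
    {H f ψ : F → F} (hf : ∀ x, f x = x ^ n * H (x ^ M)) (hψ : ∀ s, ψ s = s ^ n * H s ^ M)
    {α : Fˣ} (hα : ∀ x : Fˣ, x ∈ Subgroup.zpowers α) {ξ : F} {ℓ r : ℤ}
    (hξ : ψ^[k] ξ = ξ) (hr : ξ = ((α ^ ((M : ℤ) * r) : Fˣ) : F))
    (hℓ : ((α ^ ℓ : Fˣ) : F) = ∏ j ∈ Finset.range k, H (ψ^[j] ξ) ^ n ^ (k - j - 1)) (d : ℕ) :
    {x : F | x ^ M = ξ ∧ f^[k * d] x = x}.ncard = tau q m n k ℓ r d := by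
  have hqM : q - 1 = M * m := by rw [hM, Nat.div_mul_cancel hm]
  have hq1 : 0 < q - 1 := Nat.sub_pos_of_lt (hq ▸ Finite.one_lt_card)
  have hM0 : M ≠ 0 := fun h => by rw [h, zero_mul] at hqM; omega
  have hord : orderOf α = M * m := by
    rw [orderOf_eq_card_of_forall_mem_zpowers hα, Nat.card_units, hq, hqM]
  set A : ℕ := ∑ j ∈ Finset.range d, (n ^ k) ^ j with hA
  have hnk : 2 ≤ n ^ k := hn.trans (Nat.le_self_pow hk.ne' n)
  have hAdiv : (n ^ (d * k) - 1) / (n ^ k - 1) = A := by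
    rw [hA, Nat.geomSum_eq hnk, ← pow_mul, mul_comm d k]
  have hB : ((n ^ (d * k) - 1 : ℕ) : ℤ) = ((n : ℤ) ^ k - 1) * A := by
    rw [Nat.cast_sub (Nat.one_le_pow _ _ (by omega)), hA]
    push_cast
    rw [mul_geom_sum, ← pow_mul, mul_comm d k]
  have hfib : ∀ e : ℤ, ((α ^ e : Fˣ) : F) ^ M = ξ ↔ (m : ℤ) ∣ e - r := by
    intro e
    have h1 : ((α ^ e : Fˣ) : F) ^ M = ((α ^ ((M : ℤ) * e) : Fˣ) : F) := by
      rw [mul_comm, zpow_mul, zpow_natCast, Units.val_pow_eq_pow_val]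
    rw [h1, hr, Units.val_inj, zpow_eq_zpow_iff_modEq, hord, Int.modEq_comm, Int.modEq_iff_dvd,
      ← mul_sub, Nat.cast_mul]
    exact mul_dvd_mul_iff_left (by exact_mod_cast hM0)
  have hfix : ∀ e : ℤ, ((α ^ e : Fˣ) : F) ^ M = ξ →
      (f^[k * d] (α ^ e : Fˣ) = ((α ^ e : Fˣ) : F) ↔
        (M * m : ℤ) ∣ ℓ * A + e * (n ^ (d * k) - 1 : ℕ)) := by
    intro e he
    have hz : f^[k] (α ^ e : Fˣ) = ((α ^ (ℓ + e * ((n : ℤ) ^ k - 1)) : Fˣ) : F) * (α ^ e : Fˣ) := by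
      rw [iterate_eq_prod hf hψ, he, ← hℓ, ← Units.val_pow_eq_pow_val, ← Units.val_mul,
        ← Units.val_mul, ← zpow_natCast, ← zpow_mul, ← zpow_add, ← zpow_add]
      congr 2
      push_cast
      ring
    have hz1 : ((α ^ (ℓ + e * ((n : ℤ) ^ k - 1)) : Fˣ) : F) ^ M = 1 := by
      have h1 := iterate_pow_eq hf hψ k ((α ^ e : Fˣ) : F)
      rw [he, hξ, hz, mul_pow, he] at h1
      exact (mul_eq_right₀ (hr ▸ Units.ne_zero _)).1 h1
    rw [iterate_mul_eq_geom hf hz1 hz, ← hA, mul_eq_right₀ (Units.ne_zero _),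
      ← Units.val_pow_eq_pow_val, Units.val_eq_one, ← zpow_natCast, ← zpow_mul,
      ← orderOf_dvd_iff_zpow_eq_one, hord, hB, Nat.cast_mul]
    rw [show (ℓ + e * ((n : ℤ) ^ k - 1)) * A = ℓ * A + e * (((n : ℤ) ^ k - 1) * A) by ring]
  have hex : (∃ x : F, x ^ M = ξ ∧ f^[k * d] x = x) ↔
      ((Nat.gcd (q - 1) ((n ^ (d * k) - 1) * m) : ℕ) : ℤ) ∣
        ℓ * (A : ℤ) + r * ((n ^ (d * k) - 1 : ℕ) : ℤ) := by
    have h := exists_dvd_sub_and_dvd_iff (M := M) (m := m) (A := A) (B := (n ^ (d * k) - 1 : ℕ))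
      (ℓ := ℓ) (r := r)
    rw [← Nat.cast_mul, ← Nat.cast_mul, Int.gcd_natCast_natCast] at h
    rw [hqM, ← h]
    constructor
    · rintro ⟨x, hx, hx'⟩
      have hx0 : x ≠ 0 := by
        rintro rfl
        rw [zero_pow hM0] at hx
        exact Units.ne_zero _ (hr ▸ hx.symm)
      obtain ⟨e, he⟩ := hα (Units.mk0 x hx0)
      obtain rfl : ((α ^ e : Fˣ) : F) = x := congrArg Units.val he
      exact ⟨e, (hfib e).1 hx, by exact_mod_cast (hfix e hx).1 hx'⟩
    · rintro ⟨e, he, he'⟩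
      have he1 := (hfib e).2 he
      exact ⟨_, he1, (hfix e he1).2 (by exact_mod_cast he')⟩
  rw [tau, hAdiv]
  split_ifs with hdvd
  · obtain ⟨x₀, hx₀, hx₀'⟩ := hex.2 hdvd
    have hx0 : x₀ ≠ 0 := by
      rintro rfl
      rw [zero_pow hM0] at hx₀
      exact Units.ne_zero _ (hr ▸ hx₀.symm)
    have h := ncard_fixed_fiber (by omega) hf (hq ▸ hqM ▸ dvd_mul_right M m) (k * d) hx0 hx₀'
    rw [hx₀] at h
    rw [h, hM, mul_comm k d]
  · rw [Set.ncard_eq_zero]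
    exact Set.eq_empty_of_forall_notMem fun x hx => hdvd (hex.1 ⟨x, hx⟩)

theorem coprime_geom_sum {n k p : ℕ} (hk : 0 < k) (hp : 0 < p) :
    Nat.Coprime (∑ j ∈ Finset.range p, (n ^ k) ^ j) n := by
  obtain ⟨p, rfl⟩ := Nat.exists_eq_succ_of_ne_zero hp.ne'
  rw [Nat.succ_eq_add_one, geom_sum_succ]
  refine Nat.Coprime.coprime_dvd_right (dvd_pow_self n hk.ne') ?_
  rw [Nat.coprime_mul_left_add_left]
  exact Nat.coprime_one_left _

theorem orderOf_natCast_zmod_pos {a L : ℕ} (hL : 0 < L) (h : Nat.Coprime a L) :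
    0 < orderOf (a : ZMod L) := by
  have : NeZero L := ⟨hL.ne'⟩
  rw [← ZMod.coe_unitOfCoprime a h, orderOf_units]
  exact orderOf_pos _

/-- The ratio `z = f^[k] x / x` of a periodic point has order coprime to `n`, hence dividing
`coprimePart n (q - 1)`; this bounds the period of `x` under `f^[k]`. -/
theorem iterate_orderOf_eq_self {F : Type*} [Field F] [Finite F] {n M k : ℕ} (hn : 2 ≤ n)
    (hk : 0 < k) {H f ψ : F → F} (hf : ∀ x, f x = x ^ n * H (x ^ M))
    (hψ : ∀ s, ψ s = s ^ n * H s ^ M) {x : F} (hx : x ≠ 0) (hψx : ψ^[k] (x ^ M) = x ^ M)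
    (hper : x ∈ periodicPts f) :
    f^[k * orderOf ((n ^ k : ℕ) :
      ZMod (coprimePart n (Nat.card F - 1) * (n ^ k - 1)))] x = x := by
  have hz : f^[k] x = f^[k] x / x * x := (div_mul_cancel₀ _ hx).symm
  have hz1 : (f^[k] x / x) ^ M = 1 := by
    rw [div_pow, iterate_pow_eq hf hψ, hψx, div_self (pow_ne_zero _ hx)]
  generalize f^[k] x / x = z at hz hz1
  have hgeom := iterate_mul_eq_geom hf hz1 hz
  obtain ⟨p, hp, hpx⟩ := hper
  have h1 : z ^ (∑ j ∈ Finset.range p, (n ^ k) ^ j) = 1 := by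
    have h : f^[k * p] x = x := hpx.const_mul k
    rw [hgeom] at h
    exact (mul_eq_right₀ hx).1 h
  have hsum : ∑ j ∈ Finset.range p, (n ^ k) ^ j ≠ 0 :=
    (Finset.sum_pos (fun j _ => by positivity) ⟨0, Finset.mem_range.2 hp⟩).ne'
  have hz0 : z ≠ 0 := by
    rintro rfl
    rw [zero_pow hsum] at h1
    exact zero_ne_one h1
  have hq : 0 < Nat.card F - 1 := Nat.sub_pos_of_lt Finite.one_lt_card
  have hord : orderOf z ∣ coprimePart n (Nat.card F - 1) := by
    refine (coprimePart_spec hq).2.2 _ ?_ ?_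
    · have h := orderOf_dvd_natCard (Units.mk0 z hz0)
      rwa [Nat.card_units, ← orderOf_units, Units.val_mk0] at h
    · exact (coprime_geom_sum hk hp).coprime_dvd_left (orderOf_dvd_of_pow_eq_one h1)
  set N := orderOf ((n ^ k : ℕ) : ZMod (coprimePart n (Nat.card F - 1) * (n ^ k - 1))) with hN
  have hnk : 2 ≤ n ^ k := hn.trans (Nat.le_self_pow hk.ne' n)
  have hdvd : coprimePart n (Nat.card F - 1) * (n ^ k - 1) ∣ (n ^ k) ^ N - 1 := by
    rw [← ZMod.natCast_eq_zero_iff, Nat.cast_sub (Nat.one_le_pow _ _ (by omega)), Nat.cast_pow,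
      pow_orderOf_eq_one, Nat.cast_one, sub_self]
  have hdvd' : coprimePart n (Nat.card F - 1) ∣ ∑ j ∈ Finset.range N, (n ^ k) ^ j := by
    rw [Nat.geomSum_eq hnk]
    exact Nat.dvd_div_of_mul_dvd (by rwa [mul_comm])
  rw [hgeom, orderOf_dvd_iff_pow_eq_one.1 (hord.trans hdvd'), one_mul]

/-! ### The component of a fixed point -/

theorem mem_component_iff_of_fixed {X : Type*} {f : X → X} {o : X} (ho : f o = o) (x : X) :
    x ∈ component (functionalGraph f) o ↔ ∃ j, f^[j] x = o := by
  constructor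
  · intro h
    have key : ∀ {v w}, Relation.EqvGen (functionalGraph f).Adj v w →
        ∃ a b, f^[a] v = f^[b] w := by
      intro v w h
      induction h with
      | rel v w h => exact ⟨1, 0, h⟩
      | refl v => exact ⟨0, 0, rfl⟩
      | symm v w _ ih => obtain ⟨a, b, h⟩ := ih; exact ⟨b, a, h.symm⟩
      | trans u v w _ _ ih ih' =>
        obtain ⟨a, b, h⟩ := ih
        obtain ⟨c, d, h'⟩ := ih'
        exact ⟨c + a, b + d, by
          rw [iterate_add_apply, h, ← iterate_add_apply, Nat.add_comm c b, iterate_add_apply, h',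
            ← iterate_add_apply]⟩
    obtain ⟨a, b, hab⟩ := key h
    exact ⟨b, by rw [← hab, iterate_fixed ho]⟩
  · rintro ⟨j, hj⟩
    have key : ∀ j x, Relation.EqvGen (functionalGraph f).Adj (f^[j] x) x := by
      intro j
      induction j with
      | zero => exact fun x => Relation.EqvGen.refl x
      | succ j ih =>
        exact fun x => (ih (f x)).trans _ _ _ (Relation.EqvGen.symm _ _ (Relation.EqvGen.rel _ _ rfl))
    exact hj ▸ key j x

end FunGraph

/-! ### The graph outside the component of zero -/

theorem theorem2p4 {F : Type*} [Field F] [Finite F] (q : ℕ) (hq : Nat.card F = q)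
    (m n : ℕ) (hm : m ∣ q - 1) (hn : 2 ≤ n) (h : F[X]) (hnice : FunGraph.IsNice q m n h)
    (α : Fˣ) (hα : ∀ x : Fˣ, x ∈ Subgroup.zpowers α)
    (ν : ℕ) (hν : (q - 1) / m = ν * FunGraph.coprimePart n ((q - 1) / m))
    (t : ℕ) (S : Fin t → Set F) (k : Fin t → ℕ)
    (hdisj : ∀ i j, i ≠ j → Disjoint (S i) (S j))
    (hunion : FunGraph.unityRoots F m \ FunGraph.psiNegInf q m n h = ⋃ i, S i)
    (hcyc : ∀ i, FunGraph.Iso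
      (FunGraph.induce (FunGraph.functionalGraph (FunGraph.psi q m n h)) (S i))
      (FunGraph.cyc (k i) FunGraph.InTree.single))
    (ξ : Fin t → F) (hξ : ∀ i, ξ i ∈ S i) (ℓ r : Fin t → ℤ)
    (hr : ∀ i, ξ i = ((α ^ ((((q - 1) / m : ℕ) : ℤ) * r i) : Fˣ) : F))
    (hℓ : ∀ i, ((α ^ ℓ i : Fˣ) : F) = ∏ j ∈ Finset.range (k i),
      (h.eval ((FunGraph.psi q m n h)^[j] (ξ i))) ^ n ^ (k i - j - 1)) :
    let N : Fin t → ℕ := fun i =>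
      orderOf ((n ^ k i : ℕ) : ZMod (FunGraph.coprimePart n (q - 1) * (n ^ k i - 1)))
    ∃ c : Fin t → ℕ → ℕ,
      (∀ i, ∀ u ∈ (N i).divisors,
        (c i u : ℚ) = (∑ d ∈ u.divisors, (ArithmeticFunction.moebius (u / d) : ℚ) *
          (FunGraph.tau q m n (k i) (ℓ i) (r i) d : ℚ)) / (u : ℚ)) ∧
      FunGraph.Iso (FunGraph.graphOne (FunGraph.fPoly q m n h))
        (FunGraph.disjointUnion fun i : Fin t =>
          FunGraph.disjointUnion fun u : {u : ℕ // u ∈ (N i).divisors} =>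
            FunGraph.copies (c i u)
              (FunGraph.cyc (k i * u) (FunGraph.elemTree (FunGraph.iterGcd n ν)))) := by
  open FunGraph Function in
  intro N
  have hqM : q - 1 = (q - 1) / m * m := (Nat.div_mul_cancel hm).symm
  set M := (q - 1) / m with hM
  have hq1 : 0 < q - 1 := Nat.sub_pos_of_lt (hq ▸ Finite.one_lt_card)
  have hMpos : 0 < M := Nat.pos_of_ne_zero fun h0 => by rw [h0, zero_mul] at hqM; omega
  have hmpos : 0 < m := Nat.pos_of_ne_zero fun h0 => by rw [h0, mul_zero] at hqM; omega
  have hMdvd : M ∣ Nat.card F - 1 := hq ▸ hqM ▸ dvd_mul_right M m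
  set ψ := psi q m n h with hψdef
  set f : F → F := fun x => (fPoly q m n h).eval x with hfdef
  let H : F → F := fun s => h.eval s
  have hf : ∀ x, f x = x ^ n * H (x ^ M) := fun x => by simp [H, hfdef, fPoly, hM]
  have hψ : ∀ s, ψ s = s ^ n * H s ^ M := fun s => by simp [H, hψdef, psi, hM]
  have hsemi := iterate_pow_eq hf hψ
  -- the vertices outside the component of `0` are those lying over the cycles `S i`
  have hcomp : ∀ x, x ∈ (component (graphOf (fPoly q m n h)) 0)ᶜ ↔ x ^ M ∈ ⋃ i, S i := by
    have hf0 : f 0 = 0 := by rw [hf, zero_pow (by omega), zero_mul]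
    intro x
    rw [Set.mem_compl_iff, graphOf, mem_component_iff_of_fixed hf0, ← hunion]
    constructor
    · intro hx
      have hx0 : x ≠ 0 := fun h0 => hx ⟨0, h0⟩
      refine ⟨?_, ?_⟩
      · change (x ^ M) ^ m = 1
        rw [← pow_mul, ← hqM, ← hq, ← Nat.card_units]
        exact congrArg Units.val (pow_card_eq_one' (x := Units.mk0 x hx0))
      · rintro ⟨-, j, -, hj⟩
        exact hx ⟨j, pow_eq_zero_iff hMpos.ne' |>.1 ((hsemi j x).trans hj)⟩
    · rintro ⟨hx1, hx2⟩ ⟨j, hj⟩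
      refine hx2 ⟨hx1, j + 1, j.succ_pos, ?_⟩
      rw [← hψdef, ← hsemi, iterate_succ_apply', hj]
      rw [hf0, zero_pow hMpos.ne']
  have hcycle := fun i => (hcyc i).cyc_single
  have hkpos := fun i => (hcycle i).1
  have hSmaps := fun i => (hcycle i).2.1
  have hSper := fun i => (hcycle i).2.2.2.1
  have hne0 : ∀ s ∈ ⋃ i, S i, s ≠ 0 := by
    rintro s hs rfl
    rw [← hunion] at hs
    have h0 : (0 : F) ^ m = 1 := hs.1
    rw [zero_pow hmpos.ne'] at h0
    exact zero_ne_one h0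
  have hmaps : Set.MapsTo ψ (⋃ i, S i) (⋃ i, S i) := fun s hs => by
    obtain ⟨i, hi⟩ := Set.mem_iUnion.1 hs
    exact Set.mem_iUnion.2 ⟨i, hSmaps i s hi⟩
  have hinj : Set.InjOn ψ (⋃ i, S i) := fun s hs s' hs' => by
    have hmem : ∀ s ∈ ⋃ i, S i, s ∈ unityRoots F m \ {x | psi q m n h x = 0} := fun s hs =>
      ⟨(hunion ▸ hs : s ∈ unityRoots F m \ psiNegInf q m n h).1, hne0 _ (hmaps hs)⟩
    exact hnice (hmem s hs) (hmem s' hs')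
  have hx0 : ∀ x, x ^ M ∈ ⋃ i, S i → x ≠ 0 := fun x hx h0 =>
    hne0 _ hx (by rw [h0, zero_pow hMpos.ne'])
  have hfmaps : ∀ x, x ^ M ∈ ⋃ i, S i → ∀ j, (f^[j] x) ^ M ∈ ⋃ i, S i := fun x hx j => by
    rw [hsemi]
    exact hmaps.iterate j hx
  set W := (component (graphOf (fPoly q m n h)) 0)ᶜ with hW
  let g : W → W := fun x => ⟨f x, (hcomp _).2 (hfmaps x ((hcomp _).1 x.2) 1)⟩
  have hgval : ∀ j (x : W), (g^[j] x : F) = f^[j] x := fun j x => by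
    induction j with
    | zero => rfl
    | succ j ih => rw [iterate_succ_apply', iterate_succ_apply', ← ih]
  have hgper : ∀ x : W, minimalPeriod g x = minimalPeriod f x :=
    minimalPeriod_subtype g fun _ => rfl
  -- the tree at every periodic point
  have hνpos : 0 < ν := Nat.pos_of_ne_zero fun h0 => by rw [h0, zero_mul] at hν; omega
  have hfib : ∀ j (x : W), Nat.card {y // g^[j] y = g^[j] x} = Nat.gcd (n ^ j) ν := by
    intro j x
    have hxW := (hcomp _).1 x.2
    have h1 := ncard_iterate_fiber hf hMdvd j (hx0 x hxW) (hx0 _ (hfmaps x hxW j))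
    have h2 : Nat.gcd (n ^ j) M = Nat.gcd (n ^ j) ν := by
      rw [hν]
      exact Nat.Coprime.gcd_mul_right_cancel_right ν ((coprimePart_spec hMpos).2.1.pow_right j)
    rw [← h2, ← h1, ← Nat.card_coe_set_eq]
    refine Nat.card_congr ⟨fun y => ⟨y.1, ?_, ?_⟩, fun y => ⟨⟨y.1, ?_⟩, ?_⟩, fun _ => rfl,
      fun _ => rfl⟩
    · -- `ψ` is injective on the cycles, so that iterates of `f` separate fibres of `x ↦ x ^ M`
      refine (hinj.iterate hmaps j) ((hcomp _).1 y.1.2) hxW ?_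
      rw [← hsemi, ← hsemi, ← hgval, ← hgval, y.2]
    · rw [← hgval, ← hgval, y.2]
    · rw [hcomp, y.2.1]
      exact hxW
    · exact Subtype.ext (by rw [hgval, hgval]; exact y.2.2)
  obtain ⟨D, hD, hV, hone⟩ := iterGcd_spec n hνpos
  have hT : ∀ p ∈ periodicPts g, IsTreeAt g p (elemTree (iterGcd n ν)) :=
    isTreeAt_elemTree hfib _ D hD hV hone
  -- the number of periodic points of each period over each cycle
  let A : Fin t → ℕ → Set F := fun i u => {x | x ^ M ∈ S i ∧ minimalPeriod f x = k i * u}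
  have hdvd : ∀ i, ∀ x ∈ {x : F | x ^ M ∈ S i}, k i ∣ minimalPeriod f x := fun i x hx => by
    rw [← hSper i _ hx]
    refine IsPeriodicPt.minimalPeriod_dvd ?_
    rw [IsPeriodicPt, IsFixedPt, ← hsemi, iterate_minimalPeriod]
  have hψfix : ∀ i, ∀ s ∈ S i, ψ^[k i] s = s := fun i s hs => by
    have h0 := iterate_minimalPeriod (f := ψ) (x := s)
    rwa [hSper i s hs] at h0
  have hAsum : ∀ i, ∀ u > 0, ∑ d ∈ u.divisors, (A i d).ncard =
      k i * tau q m n (k i) (ℓ i) (r i) u := fun i u hu => by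
    have h1 := ncard_fixed_over_cycle (f := f) (ψ := ψ) (p := (· ^ M)) (hsemi 1)
      (hcycle i).2.2.2.2 (Nat.mul_pos (hkpos i) hu) (hξ i)
    rw [(hcycle i).2.2.1] at h1
    rw [← ncard_fixed_fiber_eq_tau hq hm hM hn (hkpos i) hf hψ hα (hψfix i _ (hξ i)) (hr i) (hℓ i),
      ← h1]
    exact sum_ncard_minimalPeriod f {x : F | x ^ M ∈ S i} (hkpos i) (hdvd i) hu
  have hAmaps : ∀ i u, 0 < u → ∀ x ∈ A i u, f x ∈ A i u := fun i u hu x hx =>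
    ⟨by rw [show f x ^ M = _ from hsemi 1 x]; exact hSmaps i _ hx.1, by
      rw [minimalPeriod_apply, hx.2]
      exact minimalPeriod_pos_iff_mem_periodicPts.1 (hx.2 ▸ Nat.mul_pos (hkpos i) hu)⟩
  have hc : ∀ i u, ∃ c, 0 < u → (A i u).ncard = c * (k i * u) := fun i u => by
    rcases Nat.eq_zero_or_pos u with rfl | hu
    · exact ⟨0, fun h0 => (lt_irrefl _ h0).elim⟩
    · obtain ⟨c, hc⟩ := exists_ncard_eq_mul f (A i u) (k i * u) (Nat.mul_pos (hkpos i) hu)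
        (hAmaps i u hu) fun x hx => hx.2
      exact ⟨c, fun _ => hc⟩
  choose c hc using hc
  have hNpos : ∀ i, 0 < N i := fun i => by
    have hnk : 2 ≤ n ^ k i := hn.trans (Nat.le_self_pow (hkpos i).ne' n)
    refine orderOf_natCast_zmod_pos (Nat.mul_pos ?_ (by omega)) (Nat.Coprime.mul_right ?_ ?_)
    · exact Nat.pos_of_dvd_of_pos (coprimePart_spec hq1).1 hq1
    · exact ((coprimePart_spec hq1).2.1.pow_right (k i)).symm
    · rw [Nat.coprime_self_sub_right (by omega)]
      exact Nat.coprime_one_right _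
  refine ⟨c, fun i u hu => ?_, ?_⟩
  · have hupos : 0 < u := Nat.pos_of_mem_divisors hu
    have h1 := eq_sum_moebius_of_sum_divisors (hAsum i) hupos
    have hk0 : (k i : ℚ) ≠ 0 := by exact_mod_cast (hkpos i).ne'
    have hu0 : (u : ℚ) ≠ 0 := by exact_mod_cast hupos.ne'
    rw [hc i u hupos] at h1
    push_cast at h1
    rw [eq_div_iff hu0, ← mul_right_inj' hk0, Finset.mul_sum]
    rw [show (k i : ℚ) * (c i u * u) = c i u * (k i * u) by ring, h1]
    exact Finset.sum_congr rfl fun d _ => by ring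
  · have hgraph : Iso (graphOne (fPoly q m n h)) (functionalGraph g) :=
      ⟨⟨Equiv.refl _, fun {a b} => Subtype.ext_iff⟩⟩
    refine hgraph.trans (functionalGraph_iso_disjointUnion_cyc g _ hT
      (fun i (u : {u : ℕ // u ∈ (N i).divisors}) => k i * u) (fun i u => c i u)
      (fun i u => {x : W | (x : F) ∈ A i u}) ?_ ?_ ?_ ?_ ?_ ?_)
    · exact fun i u => Nat.mul_pos (hkpos i) (Nat.pos_of_mem_divisors u.2)
    · exact fun i u x hx => hAmaps i u (Nat.pos_of_mem_divisors u.2) x hx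
    · exact fun i u x hx => (hgper x).trans hx.2
    · intro x hx
      have hxf : (x : F) ∈ periodicPts f := by
        rw [← minimalPeriod_pos_iff_mem_periodicPts, ← hgper]
        exact minimalPeriod_pos_of_mem_periodicPts hx
      obtain ⟨i, hi⟩ := Set.mem_iUnion.1 ((hcomp _).1 x.2)
      obtain ⟨u, hu⟩ := hdvd i x hi
      have h1 := iterate_orderOf_eq_self hn (hkpos i) hf hψ (hx0 _ ((hcomp _).1 x.2))
        (hψfix i _ hi) hxf
      rw [hq] at h1
      have h2 : k i * u ∣ k i * N i := hu ▸ IsPeriodicPt.minimalPeriod_dvd h1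
      exact ⟨i, ⟨u, Nat.mem_divisors.2 ⟨Nat.dvd_of_mul_dvd_mul_left (hkpos i) h2, (hNpos i).ne'⟩⟩,
        hi, hu⟩
    · rintro ⟨i, u, hu⟩ ⟨j, v, hv⟩ x hx hx'
      obtain rfl : i = j := by
        by_contra hij
        exact Set.disjoint_left.1 (hdisj i j hij) hx.1 hx'.1
      obtain rfl : u = v := Nat.eq_of_mul_eq_mul_left (hkpos i) (hx.2.symm.trans hx'.2)
      rfl
    · intro i u
      rw [← hc i u (Nat.pos_of_mem_divisors u.2)]
      refine Set.ncard_preimage_of_injective_subset_range Subtype.val_injective fun x hx => ?_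
      rw [Subtype.range_coe]
      exact (hcomp x).2 (Set.mem_iUnion.2 ⟨i, hx.1⟩)
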